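/- A $*$-noncommutative probability space is a pair $(\mathcal A,\tau)$ of a unital complex $*$-algebra $\mathcal A$ and a linear functional $\tau:\mathcal A\to\mathbb C$ with $\tau(1)=1$ and $\tau(a^*a)\ge 0$ for all $a$. An element $z\in\mathcal A$ is a $\mathrm{DT}(\mu,c)$-element ($\mu$ a compactly supported Borel probability measure on $\mathbb C$, $c>0$) if for all $k\ge 0$ and $\epsilon(1),\dots,\epsilon(k)\in\{1,*\}$ $$\tau(z^{\epsilon(1)}\cdots z^{\epsilon(k)})=\lim_{n\to\infty}\mathbb E\Big[\tfrac1n\mathrm{Tr}\big(Z_n^{\epsilon(1)}\cdots Z_n^{\epsilon(k)}\big)\Big],\qquad Z_n=D_n+cT_n,$$ where $D_n$ is a diagonal $n\times n$ random matrix with i.i.d. $\mu$-distributed diagonal entries, $T_n$ is a strictly upper triangular $n\times n$ random matrix, independent of $D_n$, whose entries above the diagonal are independent with independent centered gaussian real and imaginary parts of variance $\frac1{2n}$. The distribution of a self-adjoint element $a$ is the (unique, if it exists) compactly supported Borel probability measure $\nu$ on $\mathbb R$ with $\tau(a^p)=\int x^p\,d\nu(x)$ for all $p\ge 0$. Theorem.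 (1) Let $T$ be a $\mathrm{DT}(\delta_0,1)$-element of a $*$-noncommutative probability space $(\mathcal A,\tau)$. Then the distribution $\nu$ of $T^*T$ exists, is absolutely continuous with respect to Lebesgue measure, and has support $[0,e]$. The map $v\mapsto\frac{\sin v}{v}e^{v\cot v}$ is a bijection from $(0,\pi)$ onto $(0,e)$, and the density of $\nu$ is the function $\varphi$ that vanishes outside $(0,e)$ and is given on $(0,e)$ by $$\varphi\Big(\frac{\sin v}{v}e^{v\cot v}\Big)=\frac1\pi\sin v\;e^{-v\cot v},\qquad 0<v<\pi.$$ (2) Let $\mathcal M$ be a von Neumann algebra on a Hilbert space $\mathcal H$ with a faithful normal state $\tau$, and let $T\in\mathcal M$ be a $\mathrm{DT}(\delta_0,1)$-element of $(\mathcal M,\tau)$. Then $\|T\|=\sqrt e$ and $\ker T=\ker(T^*T)=\{0\}$. -/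

import Mathlib

open MeasureTheory ProbabilityTheory Filter Topology

noncomputable section

namespace FreeProb

/-- `(A, τ)` is a `*`-noncommutative probability space: `τ` is a linear functional on the unital
complex `*`-algebra `A` with `τ 1 = 1` and `τ (a* a) ≥ 0` for every `a`. -/
structure IsState {A : Type*} [Ring A] [StarRing A] [Algebra ℂ A] [StarModule ℂ A]
    (τ : A →ₗ[ℂ] ℂ) : Prop where
  map_one : τ 1 = 1
  re_nonneg : ∀ a : A, 0 ≤ (τ (star a * a)).re
  im_eq_zero : ∀ a : A, (τ (star a * a)).im = 0

/-- The word `z^{ε(1)} z^{ε(2)} ⋯ z^{ε(k)}` in `z` and `z*`; the letter `true` stands for `*` and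
`false` for `1`. -/
def starWord {A : Type*} [Monoid A] [Star A] (z : A) (ε : List Bool) : A :=
  (ε.map fun b => if b then star z else z).prod

/-- The law on `ℂ` of a complex `N(0, s)` variable: real and imaginary parts are independent
centered gaussian variables of variance `s / 2`. -/
def complexGaussian (s : NNReal) : Measure ℂ :=
  ((gaussianReal 0 (s / 2)).prod (gaussianReal 0 (s / 2))).map
    Complex.measurableEquivRealProd.symm

/-- The sample space for the pair `(D_n, T_n)`: the first factor carries the diagonal entries of
`D_n`, the second one the entries of `T_n` (only those with `i < j` are used). -/
abbrev DTSample (n : ℕ) : Type := (Fin n → ℂ) × (Fin n × Fin n → ℂ)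

/-- The probability measure under which all coordinates are independent, those of the first
factor with law `μ` and those of the second factor complex `N(0, 1/n)`. -/
def dtMeasure (μ : Measure ℂ) (n : ℕ) : Measure (DTSample n) :=
  (Measure.pi fun _ => μ).prod (Measure.pi fun _ => complexGaussian (1 / (n : NNReal)))

/-- The diagonal random matrix with i.i.d. diagonal entries. -/
def diagRM (n : ℕ) (ω : DTSample n) : Matrix (Fin n) (Fin n) ℂ :=
  Matrix.diagonal ω.1

/-- The strictly upper triangular gaussian random matrix. -/
def upperRM (n : ℕ) (ω : DTSample n) : Matrix (Fin n) (Fin n) ℂ :=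
  Matrix.of fun i j => if i < j then ω.2 (i, j) else 0

/-- The random matrix `Z_n = D_n + c T_n`. -/
def dtRM (c : ℝ) (n : ℕ) (ω : DTSample n) : Matrix (Fin n) (Fin n) ℂ :=
  diagRM n ω + (c : ℂ) • upperRM n ω

/-- The `*`-moment `τ_n (Z_n^{ε(1)} ⋯ Z_n^{ε(k)})`, where `τ_n` is the expectation of the
normalized trace. -/
def dtMoment (μ : Measure ℂ) (c : ℝ) (n : ℕ) (ε : List Bool) : ℂ :=
  ∫ ω, (n : ℂ)⁻¹ * (starWord (dtRM c n ω) ε).trace ∂(dtMeasure μ n)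

/-- `z` is a `DT(μ, c)`-element with respect to `τ`, for a compactly supported Borel probability
measure `μ` on `ℂ` and `c > 0`: the `*`-moments of `z` are the limits of those of
`D_n + c T_n`. -/
structure IsDTElement {A : Type*} [Ring A] [StarRing A] [Algebra ℂ A] [StarModule ℂ A]
    (τ : A →ₗ[ℂ] ℂ) (μ : Measure ℂ) [IsProbabilityMeasure μ] (c : ℝ) (z : A) : Prop where
  isCompact_support : IsCompact μ.support
  pos : 0 < c
  tendsto : ∀ ε : List Bool,
    Tendsto (fun n : ℕ => dtMoment μ c n ε) atTop (𝓝 (τ (starWord z ε)))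

/-- `ν` is the distribution of the (self-adjoint) element `a` with respect to `τ`: a compactly
supported Borel probability measure on `ℝ` with the same moments. -/
structure IsDistribution {A : Type*} [Ring A] [Algebra ℂ A]
    (τ : A →ₗ[ℂ] ℂ) (a : A) (ν : Measure ℝ) : Prop where
  isProbabilityMeasure : IsProbabilityMeasure ν
  isCompact_support : IsCompact ν.support
  moment : ∀ p : ℕ, τ (a ^ p) = ((∫ x, x ^ p ∂ν : ℝ) : ℂ)

section VonNeumann

variable {H : Type*} [NormedAddCommGroup H] [InnerProductSpace ℂ H] [CompleteSpace H]

/-- Normality of a functional on a von Neumann algebra `M` on `H` (with its order as a set of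
operators): suprema of increasing nets of positive elements are preserved. -/
def IsNormal (M : VonNeumannAlgebra H) (τ : M.toStarSubalgebra →ₗ[ℂ] ℂ) : Prop :=
  ∀ (S : Set M.toStarSubalgebra) (x : M.toStarSubalgebra), S.Nonempty →
    DirectedOn (fun a b : M.toStarSubalgebra => (a : H →L[ℂ] H) ≤ (b : H →L[ℂ] H)) S → (∀ a ∈ S, 0 ≤ (a : H →L[ℂ] H)) →
    ((∀ a ∈ S, (a : H →L[ℂ] H) ≤ (x : H →L[ℂ] H)) ∧
      ∀ y : M.toStarSubalgebra, (∀ a ∈ S, (a : H →L[ℂ] H) ≤ (y : H →L[ℂ] H)) → (x : H →L[ℂ] H) ≤ (y : H →L[ℂ] H)) →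
    IsLUB ((fun a : M.toStarSubalgebra => (τ a).re) '' S) (τ x).re

/-- `(M, τ)` is a `W*`-noncommutative probability space whose normal state `τ` is faithful. -/
structure IsFaithfulNormalState (M : VonNeumannAlgebra H)
    (τ : M.toStarSubalgebra →ₗ[ℂ] ℂ) : Prop where
  isState : IsState τ
  isNormal : IsNormal M τ
  faithful : ∀ a : M.toStarSubalgebra, τ (star a * a) = 0 → a = 0

end VonNeumann

/-- The parametrization `v ↦ (sin v / v) exp (v cot v)`. -/
def rho (v : ℝ) : ℝ := Real.sin v / v * Real.exp (v * Real.cot v)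

end FreeProb

end

/-! ### Gaussian integration by parts and the moments of a complex gaussian variable -/

noncomputable section
namespace FreeProb
open Complex

/-! Everything rests on the moments τ((T*T)^p) = p^p/(p+1)!. They follow from a finer statement
about the matrix model: the i-th diagonal entry of (T_n* T_n)^p concentrates in L² around A_p(i/n),
and that of (T_n T_n*)^p around A_p(1 - i/n), where A_p(x) = x (x+p)^(p-1) / p! is the normalized
Abel polynomial. Gaussian integration by parts (`IBPPair.loop`) writes E[((T*T)^(p+1))_ii Q] as 1/n
times the sum over j < i and k ≤ p of E[((TT*)^k)_jj ((T*T)^(p-k))_ii Q], plus a term in which Q is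
differentiated. With Q = 1 this gives the mean; with Q the entry itself it gives the second moment
up to O(1/n). Concentration therefore propagates by induction on p (`exists_tendsto_diagEntry`). The
limiting recursion A_{p+1}(x) = Σ_k (∫_0^x A_k(1-t) dt) A_{p-k}(x) is the binomial-type identity of
the Abel polynomials at the pair (-x, x) (`sum_neg_abelPoly_mul`), and ∫_0^1 A_p = p^p/(p+1)! is the
limiting normalized trace.

On the side of the density, put ψ = φ ∘ ρ. Then ψ' = 1/(πρ), and integrating the derivative of
ρ^(p+1) ψ turns ∫ x^p φ(x) dx into (1/((p+1)π)) ∫_0^π ρ^p. The last integral is π p^p/p!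
(`integral_rho_pow`): ρ(v)^p is the value of the entire function exp(p(e^ζ - ζ)) along a curve on
which that function is real. The curve can be deformed to the segment from 0 to iπ, which carries
half of a Cauchy integral for a Taylor coefficient of e^(pz). Weierstrass approximation gives
uniqueness (`measure_eq_of_moments`).

In the von Neumann algebra, positivity of τ extends the moment identity from polynomials to
continuous functions of T*T (`re_apply_cfc`). Faithfulness then identifies the spectrum of T*T with
the support [0, e], which gives the norm (`spectrum_eq_support`). The kernel projection lies below
functions of T*T that decrease to the indicator of {0}, and the distribution has no atom there
(`ker_eq_bot_of_measure_singleton`). -/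

lemma hasDerivAt_gaussianPDFReal (v : NNReal) (x : ℝ) :
    HasDerivAt (gaussianPDFReal 0 v) (-(x / v) * gaussianPDFReal 0 v x) x := by
  have h : HasDerivAt (fun y : ℝ => (√(2 * Real.pi * v))⁻¹ * Real.exp (-(y - 0) ^ 2 / (2 * v)))
      ((√(2 * Real.pi * v))⁻¹ * (Real.exp (-(x - 0) ^ 2 / (2 * v)) *
        (-(2 * (x - 0)) / (2 * v)))) x := by
    refine HasDerivAt.const_mul _ (HasDerivAt.exp ?_)
    refine HasDerivAt.div_const ?_ _
    have := (((hasDerivAt_id' x).sub_const 0).fun_pow 2).fun_neg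
    simpa using this
  have h' : gaussianPDFReal 0 v =
      fun y : ℝ => (√(2 * Real.pi * v))⁻¹ * Real.exp (-(y - 0) ^ 2 / (2 * v)) := rfl
  rw [h']
  convert h using 1
  simp only [sub_zero]
  have : -(2 * x) / (2 * (v : ℝ)) = -(x / v) := by
    rw [neg_div, mul_div_mul_left _ _ (two_ne_zero)]
  rw [this]; ring

lemma integrable_gaussianReal_iff {v : NNReal} (hv : v ≠ 0) (f : ℝ → ℂ) :
    Integrable f (gaussianReal 0 v) ↔ Integrable (fun x => gaussianPDFReal 0 v x • f x) := by
  rw [gaussianReal_of_var_ne_zero _ hv, integrable_withDensity_iff_integrable_smul'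
    (measurable_gaussianPDF 0 v) (ae_of_all _ fun x => gaussianPDF_lt_top)]
  simp only [toReal_gaussianPDF]

/-- Gaussian integration by parts. -/
lemma integral_mul_gaussianReal (v : NNReal) (f f' : ℝ → ℂ) (hf : ∀ x, HasDerivAt f (f' x) x)
    (h1 : Integrable f (gaussianReal 0 v)) (h2 : Integrable f' (gaussianReal 0 v))
    (h3 : Integrable (fun x : ℝ => (x : ℂ) * f x) (gaussianReal 0 v)) :
    ∫ x : ℝ, (x : ℂ) * f x ∂(gaussianReal 0 v) = v * ∫ x, f' x ∂(gaussianReal 0 v) := by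
  -- Variance 0 is the Dirac mass at 0, where both sides vanish. It does occur: the variance 1/n has
  -- the value 0 at n = 0.
  rcases eq_or_ne v 0 with rfl | hv
  · simp
  rw [integrable_gaussianReal_iff hv] at h1 h2 h3
  rw [integral_gaussianReal_eq_integral_smul hv, integral_gaussianReal_eq_integral_smul hv]
  have hvc : ((v : ℝ) : ℂ) ≠ 0 := by exact_mod_cast hv
  have hd : ∀ x : ℝ, HasDerivAt (fun y : ℝ => ((gaussianPDFReal 0 v y : ℝ) : ℂ))
      (((-(x / v) * gaussianPDFReal 0 v x : ℝ)) : ℂ) x := fun x =>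
    (hasDerivAt_gaussianPDFReal v x).ofReal_comp
  have key := integral_mul_deriv_eq_deriv_mul_of_integrable (u := f) (u' := f')
    (v := fun y : ℝ => ((gaussianPDFReal 0 v y : ℝ) : ℂ)) (fun x _ => hf x) (fun x _ => hd x)
    (by
      have := h3.const_mul (-((v : ℝ) : ℂ)⁻¹)
      refine this.congr (ae_of_all _ fun x => ?_)
      simp only [real_smul, Pi.mul_apply]; push_cast; ring)
    (by
      refine h2.congr (ae_of_all _ fun x => ?_)
      simp only [real_smul, Pi.mul_apply]; ring)
    (by
      refine h1.congr (ae_of_all _ fun x => ?_)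
      simp only [real_smul, Pi.mul_apply]; ring)
  have e1 : ∫ x : ℝ, f x * (((-(x / v) * gaussianPDFReal 0 v x : ℝ)) : ℂ) =
      -((v : ℝ) : ℂ)⁻¹ * ∫ x : ℝ, gaussianPDFReal 0 v x • ((x : ℂ) * f x) := by
    rw [← integral_const_mul]
    congr 1; ext x; simp only [real_smul]; push_cast; ring
  have e2 : ∫ x, f' x * ((gaussianPDFReal 0 v x : ℝ) : ℂ) =
      ∫ x, gaussianPDFReal 0 v x • f' x := by
    congr 1; ext x; simp only [real_smul]; ring
  rw [e1, e2] at key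
  have := congrArg (fun t => -((v : ℝ) : ℂ) * t) key
  rw [← mul_assoc, neg_mul_neg, mul_inv_cancel₀ hvc, one_mul, neg_mul_neg] at this
  exact this

lemma norm_mk_pow_le (x y : ℝ) (m : ℕ) :
    ‖((x : ℂ) + y * I)‖ ^ m ≤ 2 ^ m * (|x| ^ m + |y| ^ m) := by
  have h1 : ‖((x : ℂ) + y * I)‖ ≤ |x| + |y| := by
    refine (norm_add_le _ _).trans ?_
    simp
  have h2 : |x| + |y| ≤ 2 * max |x| |y| := by
    rw [two_mul]; exact add_le_add (le_max_left _ _) (le_max_right _ _)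
  calc ‖((x : ℂ) + y * I)‖ ^ m ≤ (2 * max |x| |y|) ^ m := by gcongr; exact h1.trans h2
    _ = 2 ^ m * (max |x| |y|) ^ m := mul_pow _ _ _
    _ ≤ _ := by
      gcongr
      rcases max_cases |x| |y| with ⟨h, -⟩ | ⟨h, -⟩ <;> rw [h]
      · exact le_add_of_nonneg_right (by positivity)
      · exact le_add_of_nonneg_left (by positivity)

lemma integrable_abs_pow_gaussianReal (v : NNReal) (m : ℕ) :
    Integrable (fun x : ℝ => |x| ^ m) (gaussianReal 0 v) := by
  have := (memLp_id_gaussianReal' (μ := 0) (v := v) (m : ENNReal) (by simp)).integrable_norm_pow'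
  simpa using this

/-- The monomials `z ^ k * conj z ^ l` in real coordinates. -/
def zmono (k l : ℕ) (x y : ℝ) : ℂ := ((x : ℂ) + y * I) ^ k * ((x : ℂ) - y * I) ^ l

lemma norm_zmono (k l : ℕ) (x y : ℝ) : ‖zmono k l x y‖ = ‖((x : ℂ) + y * I)‖ ^ (k + l) := by
  have : (x : ℂ) - y * I = (starRingEnd ℂ) ((x : ℂ) + y * I) := by simp [sub_eq_add_neg]
  rw [zmono, norm_mul, norm_pow, norm_pow, this, Complex.norm_conj, pow_add]

lemma continuous_zmono (k l : ℕ) : Continuous fun p : ℝ × ℝ => zmono k l p.1 p.2 := by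
  unfold zmono; fun_prop

lemma integrable_zmono_left (s : NNReal) (k l : ℕ) (y : ℝ) :
    Integrable (fun x => zmono k l x y) (gaussianReal 0 s) := by
  refine Integrable.mono' (g := fun x => 2 ^ (k + l) * (|x| ^ (k + l) + |y| ^ (k + l))) ?_ ?_ ?_
  · exact ((integrable_abs_pow_gaussianReal s _).add (integrable_const _)).const_mul _
  · exact (by unfold zmono; fun_prop : Continuous fun x => zmono k l x y).aestronglyMeasurable
  · exact ae_of_all _ fun x => by rw [norm_zmono]; exact norm_mk_pow_le _ _ _

lemma integrable_zmono_right (s : NNReal) (k l : ℕ) (x : ℝ) :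
    Integrable (fun y => zmono k l x y) (gaussianReal 0 s) := by
  refine Integrable.mono' (g := fun y => 2 ^ (k + l) * (|x| ^ (k + l) + |y| ^ (k + l))) ?_ ?_ ?_
  · exact ((integrable_const _).add (integrable_abs_pow_gaussianReal s _)).const_mul _
  · exact (by unfold zmono; fun_prop : Continuous fun y => zmono k l x y).aestronglyMeasurable
  · exact ae_of_all _ fun y => by rw [norm_zmono]; exact norm_mk_pow_le _ _ _

lemma integrable_zmono (s : NNReal) (k l : ℕ) :
    Integrable (fun p : ℝ × ℝ => zmono k l p.1 p.2)
      ((gaussianReal 0 s).prod (gaussianReal 0 s)) := by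
  refine Integrable.mono'
    (g := fun p : ℝ × ℝ => 2 ^ (k + l) * (|p.1| ^ (k + l) + |p.2| ^ (k + l))) ?_ ?_ ?_
  · exact (((integrable_abs_pow_gaussianReal s _).comp_fst _).add
      ((integrable_abs_pow_gaussianReal s _).comp_snd _)).const_mul _
  · exact (continuous_zmono k l).aestronglyMeasurable
  · exact ae_of_all _ fun p => by rw [norm_zmono]; exact norm_mk_pow_le _ _ _

/-- The moments of the product of two real gaussian variables of variance `s`. -/
def zmom (s : NNReal) (k l : ℕ) : ℂ :=
  ∫ p : ℝ × ℝ, zmono k l p.1 p.2 ∂((gaussianReal 0 s).prod (gaussianReal 0 s))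

lemma ofReal_mul_zmono (k l : ℕ) (x y : ℝ) :
    (x : ℂ) * zmono k l x y = (1 / 2) * (zmono (k + 1) l x y + zmono k (l + 1) x y) := by
  simp only [zmono]; ring

lemma ofReal_mul_zmono' (k l : ℕ) (x y : ℝ) :
    (y : ℂ) * zmono k l x y = (-I / 2) * (zmono (k + 1) l x y - zmono k (l + 1) x y) := by
  have : (y : ℂ) = (-I / 2) * (((x : ℂ) + y * I) - ((x : ℂ) - y * I)) := by
    ring_nf; rw [I_sq]; ring
  conv_lhs => rw [this]
  simp only [zmono]; ring

/-- Integration by parts in the real coordinate x = (z + conj z)/2. The truncated exponents k - 1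
and l - 1 are harmless because of the factors k and l. The companion identity in y = (z - conj
z)/(2i) gives the difference, and the two together isolate each summand. -/
lemma integral_fst_mul_zmono (s : NNReal) (k l : ℕ) :
    zmom s (k + 1) l + zmom s k (l + 1) =
      2 * s * (k * zmom s (k - 1) l + l * zmom s k (l - 1)) := by
  have hI := integrable_zmono s
  have e : ∀ y : ℝ, ∫ x : ℝ, (x : ℂ) * zmono k l x y ∂(gaussianReal 0 s) =
      s * ∫ x, (k * zmono (k - 1) l x y + l * zmono k (l - 1) x y) ∂(gaussianReal 0 s) := by
    intro y
    have i1 := integrable_zmono_left s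
    refine integral_mul_gaussianReal s _ _ (fun x => ?_) (i1 _ _ _)
      (((i1 _ _ _).const_mul _).add ((i1 _ _ _).const_mul _)) ?_
    · have a1 : HasDerivAt (fun x : ℝ => (x : ℂ) + y * I) 1 x :=
        (Complex.ofRealCLM.hasDerivAt (x := x)).add_const _
      have a2 : HasDerivAt (fun x : ℝ => (x : ℂ) - y * I) 1 x :=
        (Complex.ofRealCLM.hasDerivAt (x := x)).sub_const _
      exact ((a1.fun_pow k).fun_mul (a2.fun_pow l)).congr_deriv (by simp only [zmono]; ring)
    · simp only [ofReal_mul_zmono]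
      exact ((i1 _ _ _).add (i1 _ _ _)).const_mul _
  have h1 : ∫ p : ℝ × ℝ, (p.1 : ℂ) * zmono k l p.1 p.2
        ∂((gaussianReal 0 s).prod (gaussianReal 0 s)) =
      s * ∫ p : ℝ × ℝ, (k * zmono (k - 1) l p.1 p.2 + l * zmono k (l - 1) p.1 p.2)
        ∂((gaussianReal 0 s).prod (gaussianReal 0 s)) := by
    rw [integral_prod_symm, integral_prod_symm, ← integral_const_mul]
    · exact integral_congr_ae (ae_of_all _ e)
    · exact ((hI _ _).const_mul _).add ((hI _ _).const_mul _)
    · simp only [ofReal_mul_zmono]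
      exact ((hI _ _).add (hI _ _)).const_mul _
  simp only [ofReal_mul_zmono] at h1
  rw [integral_const_mul, integral_add (hI _ _) (hI _ _), integral_add ((hI _ _).const_mul _)
    ((hI _ _).const_mul _), integral_const_mul, integral_const_mul] at h1
  change 1 / 2 * (zmom s (k + 1) l + zmom s k (l + 1)) =
    s * (k * zmom s (k - 1) l + l * zmom s k (l - 1)) at h1
  linear_combination 2 * h1

lemma integral_snd_mul_zmono (s : NNReal) (k l : ℕ) :
    zmom s (k + 1) l - zmom s k (l + 1) =
      2 * s * (l * zmom s k (l - 1) - k * zmom s (k - 1) l) := by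
  have hI := integrable_zmono s
  have e : ∀ x : ℝ, ∫ y : ℝ, (y : ℂ) * zmono k l x y ∂(gaussianReal 0 s) =
      s * ∫ y, ((k * I) * zmono (k - 1) l x y + (-l * I) * zmono k (l - 1) x y)
        ∂(gaussianReal 0 s) := by
    intro x
    have i1 := integrable_zmono_right s
    refine integral_mul_gaussianReal s _ _ (fun y => ?_) (i1 _ _ _)
      (((i1 _ _ _).const_mul _).add ((i1 _ _ _).const_mul _)) ?_
    · have a1 : HasDerivAt (fun y : ℝ => (x : ℂ) + y * I) (1 * I) y :=
        ((Complex.ofRealCLM.hasDerivAt (x := y)).mul_const I).const_add _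
      have a2 : HasDerivAt (fun y : ℝ => (x : ℂ) - y * I) (-(1 * I)) y :=
        ((Complex.ofRealCLM.hasDerivAt (x := y)).mul_const I).const_sub _
      exact ((a1.fun_pow k).fun_mul (a2.fun_pow l)).congr_deriv (by simp only [zmono]; ring)
    · simp only [ofReal_mul_zmono']
      exact ((i1 _ _ _).sub (i1 _ _ _)).const_mul _
  have h1 : ∫ p : ℝ × ℝ, (p.2 : ℂ) * zmono k l p.1 p.2
        ∂((gaussianReal 0 s).prod (gaussianReal 0 s)) =
      s * ∫ p : ℝ × ℝ, ((k * I) * zmono (k - 1) l p.1 p.2 + (-l * I) * zmono k (l - 1) p.1 p.2)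
        ∂((gaussianReal 0 s).prod (gaussianReal 0 s)) := by
    rw [integral_prod, integral_prod, ← integral_const_mul]
    · exact integral_congr_ae (ae_of_all _ e)
    · exact ((hI _ _).const_mul _).add ((hI _ _).const_mul _)
    · simp only [ofReal_mul_zmono']
      exact ((hI _ _).sub (hI _ _)).const_mul _
  simp only [ofReal_mul_zmono'] at h1
  rw [integral_const_mul, integral_sub (hI _ _) (hI _ _), integral_add ((hI _ _).const_mul _)
    ((hI _ _).const_mul _), integral_const_mul, integral_const_mul] at h1
  change -I / 2 * (zmom s (k + 1) l - zmom s k (l + 1)) =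
    s * (k * I * zmom s (k - 1) l + -l * I * zmom s k (l - 1)) at h1
  linear_combination (2 * I) * h1 +
    (zmom s (k + 1) l - zmom s k (l + 1) + 2 * s * (k * zmom s (k - 1) l - l * zmom s k (l - 1))) *
      I_sq

/-- The `*`-moments of a complex gaussian variable. -/
def cgMoment (s : NNReal) (k l : ℕ) : ℂ :=
  ∫ z, z ^ k * (starRingEnd ℂ) z ^ l ∂(complexGaussian s)

lemma measurableEquivRealProd_symm_eq (p : ℝ × ℝ) :
    Complex.measurableEquivRealProd.symm p = (p.1 : ℂ) + p.2 * I := by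
  apply Complex.ext <;> simp

lemma zmono_eq (k l : ℕ) (p : ℝ × ℝ) :
    (Complex.measurableEquivRealProd.symm p) ^ k *
      (starRingEnd ℂ) (Complex.measurableEquivRealProd.symm p) ^ l = zmono k l p.1 p.2 := by
  rw [measurableEquivRealProd_symm_eq, zmono]
  simp [sub_eq_add_neg]

lemma cgMoment_eq (s : NNReal) (k l : ℕ) : cgMoment s k l = zmom (s / 2) k l := by
  rw [cgMoment, complexGaussian, integral_map_equiv, zmom]
  simp only [zmono_eq]

lemma integrable_cg (s : NNReal) (k l : ℕ) :
    Integrable (fun z : ℂ => z ^ k * (starRingEnd ℂ) z ^ l) (complexGaussian s) := by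
  rw [complexGaussian, integrable_map_equiv]
  refine (integrable_zmono (s / 2) k l).congr (ae_of_all _ fun p => ?_)
  exact (zmono_eq k l p).symm

/-- Half the difference of the two real identities: E[conj z · F] = s E[∂F/∂z] for a monomial F. The
coordinates have variance s/2, which turns the constant 2 · (s/2) into s. -/
lemma cgMoment_succ_right (s : NNReal) (k l : ℕ) :
    cgMoment s k (l + 1) = s * (k * cgMoment s (k - 1) l) := by
  simp only [cgMoment_eq]
  have h1 := integral_fst_mul_zmono (s / 2) k l
  have h2 := integral_snd_mul_zmono (s / 2) k l
  have h3 : (((s / 2 : NNReal) : ℝ) : ℂ) = (s : ℝ) / 2 := by push_cast; rfl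
  rw [h3] at h1 h2
  linear_combination (1 / 2) * h1 - (1 / 2) * h2

lemma cgMoment_succ_left (s : NNReal) (k l : ℕ) :
    cgMoment s (k + 1) l = s * (l * cgMoment s k (l - 1)) := by
  simp only [cgMoment_eq]
  have h1 := integral_fst_mul_zmono (s / 2) k l
  have h2 := integral_snd_mul_zmono (s / 2) k l
  have h3 : (((s / 2 : NNReal) : ℝ) : ℂ) = (s : ℝ) / 2 := by push_cast; rfl
  rw [h3] at h1 h2
  linear_combination (1 / 2) * h1 + (1 / 2) * h2

instance (s : NNReal) : IsProbabilityMeasure (complexGaussian s) := by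
  unfold complexGaussian
  exact Measure.isProbabilityMeasure_map (MeasurableEquiv.measurable _).aemeasurable

end FreeProb
end

noncomputable section
namespace FreeProb
open Complex

/-! ### Wick calculus for polynomials in independent complex gaussian variables -/

section GaussianPolynomials
variable {K : Type*} [Fintype K]

/-- Polynomials in the variables `z_a` (`Sum.inl a`) and their conjugates (`Sum.inr a`). -/
abbrev GPoly (K : Type*) : Type _ := MvPolynomial (K ⊕ K) ℂ

/-- Evaluation of a polynomial in `z_a` and `conj z_a` at a point. -/
def evalAt (ω : K → ℂ) : GPoly K →ₐ[ℂ] ℂ :=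
  MvPolynomial.aeval (Sum.elim ω fun a => (starRingEnd ℂ) (ω a))

lemma evalAt_monomial (ω : K → ℂ) (m : K ⊕ K →₀ ℕ) (c : ℂ) :
    evalAt ω (MvPolynomial.monomial m c) =
      c * ∏ a, (ω a ^ m (Sum.inl a) * (starRingEnd ℂ) (ω a) ^ m (Sum.inr a)) := by
  rw [evalAt, MvPolynomial.aeval_monomial, Finsupp.prod_fintype _ _ (fun i => pow_zero _),
    Fintype.prod_sum_type, Finset.prod_mul_distrib]
  rfl

lemma integrable_evalAt (s : NNReal) (P : GPoly K) :
    Integrable (fun ω => evalAt ω P) (Measure.pi fun _ : K => complexGaussian s) := by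
  induction P using MvPolynomial.induction_on' with
  | monomial m c =>
    simp only [evalAt_monomial]
    refine Integrable.const_mul ?_ c
    exact Integrable.fintype_prod (f := fun a z => z ^ m (Sum.inl a) *
      (starRingEnd ℂ) z ^ m (Sum.inr a)) fun a => integrable_cg s _ _
  | add p q hp hq =>
    simp only [map_add]
    exact hp.add hq

/-- Expectation of a polynomial in independent complex gaussian variables of variance `s`. -/
def gexp (s : NNReal) : GPoly K →ₗ[ℂ] ℂ where
  toFun P := ∫ ω, evalAt ω P ∂(Measure.pi fun _ : K => complexGaussian s)
  map_add' P Q := by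
    simp only [map_add]
    exact integral_add (integrable_evalAt s P) (integrable_evalAt s Q)
  map_smul' c P := by
    simp only [map_smul, integral_smul, RingHom.id_apply]

lemma gexp_apply (s : NNReal) (P : GPoly K) :
    gexp s P = ∫ ω, evalAt ω P ∂(Measure.pi fun _ : K => complexGaussian s) := rfl

lemma gexp_monomial (s : NNReal) (m : K ⊕ K →₀ ℕ) (c : ℂ) :
    gexp s (MvPolynomial.monomial m c) =
      c * ∏ a, cgMoment s (m (Sum.inl a)) (m (Sum.inr a)) := by
  simp only [gexp_apply, evalAt_monomial]
  rw [integral_const_mul, integral_fintype_prod_eq_prod (fun a z => z ^ m (Sum.inl a) *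
      (starRingEnd ℂ) z ^ m (Sum.inr a))]
  rfl

variable [DecidableEq K]

/-- By linearity a monomial suffices. Its expectation factors over the variables, and only the
factor at a changes, according to the one-variable recursion. -/
lemma gexp_X_inr_mul (s : NNReal) (a : K) (P : GPoly K) :
    gexp s (MvPolynomial.X (Sum.inr a) * P) =
      s * gexp s (MvPolynomial.pderiv (Sum.inl a) P) := by
  induction P using MvPolynomial.induction_on' with
  | monomial m c =>
    rw [MvPolynomial.X, MvPolynomial.monomial_mul, MvPolynomial.pderiv_monomial, gexp_monomial,
      gexp_monomial, ← Finset.mul_prod_erase _ _ (Finset.mem_univ a),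
      ← Finset.mul_prod_erase Finset.univ (fun b => cgMoment s _ _) (Finset.mem_univ a)]
    have h : ∏ b ∈ Finset.univ.erase a,
          cgMoment s (((Finsupp.single (Sum.inr a) 1 + m : K ⊕ K →₀ ℕ)) (Sum.inl b))
            (((Finsupp.single (Sum.inr a) 1 + m : K ⊕ K →₀ ℕ)) (Sum.inr b)) =
        ∏ b ∈ Finset.univ.erase a, cgMoment s (((m - Finsupp.single (Sum.inl a) 1 : K ⊕ K →₀ ℕ)) (Sum.inl b))
            (((m - Finsupp.single (Sum.inl a) 1 : K ⊕ K →₀ ℕ)) (Sum.inr b)) := by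
      refine Finset.prod_congr rfl fun b hb => ?_
      have hb' : a ≠ b := (Finset.ne_of_mem_erase hb).symm
      simp [hb']
    rw [h]
    simp only [Finsupp.add_apply, Finsupp.tsub_apply, Finsupp.single_apply, reduceCtorEq,
      if_false, if_true, zero_add, tsub_zero]
    rw [add_comm 1, cgMoment_succ_right]
    ring
  | add p q hp hq => simp only [mul_add, map_add, hp, hq]

lemma gexp_X_inl_mul (s : NNReal) (a : K) (P : GPoly K) :
    gexp s (MvPolynomial.X (Sum.inl a) * P) =
      s * gexp s (MvPolynomial.pderiv (Sum.inr a) P) := by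
  induction P using MvPolynomial.induction_on' with
  | monomial m c =>
    rw [MvPolynomial.X, MvPolynomial.monomial_mul, MvPolynomial.pderiv_monomial, gexp_monomial,
      gexp_monomial, ← Finset.mul_prod_erase _ _ (Finset.mem_univ a),
      ← Finset.mul_prod_erase Finset.univ (fun b => cgMoment s _ _) (Finset.mem_univ a)]
    have h : ∏ b ∈ Finset.univ.erase a,
          cgMoment s (((Finsupp.single (Sum.inl a) 1 + m : K ⊕ K →₀ ℕ)) (Sum.inl b))
            (((Finsupp.single (Sum.inl a) 1 + m : K ⊕ K →₀ ℕ)) (Sum.inr b)) =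
        ∏ b ∈ Finset.univ.erase a, cgMoment s (((m - Finsupp.single (Sum.inr a) 1 : K ⊕ K →₀ ℕ)) (Sum.inl b))
            (((m - Finsupp.single (Sum.inr a) 1 : K ⊕ K →₀ ℕ)) (Sum.inr b)) := by
      refine Finset.prod_congr rfl fun b hb => ?_
      have hb' : a ≠ b := (Finset.ne_of_mem_erase hb).symm
      simp [hb']
    rw [h]
    simp only [Finsupp.add_apply, Finsupp.tsub_apply, Finsupp.single_apply, reduceCtorEq,
      if_false, if_true, zero_add, tsub_zero]
    rw [add_comm 1, cgMoment_succ_left]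
    ring
  | add p q hp hq => simp only [mul_add, map_add, hp, hq]

end GaussianPolynomials

/-! ### The loop equations -/

section Loop
variable {ι R : Type*} [Fintype ι] [DecidableEq ι] [CommRing R] [Algebra ℂ R]

/-- Two matrices `U`, `V` over a commutative algebra with a linear functional `E` for which the
entries of `U` integrate by parts against those of `V`. -/
structure IBPPair (E : R →ₗ[ℂ] ℂ) (v : ℂ) (U V : Matrix ι ι R) (r : ι → ι → Prop)
    (d : ι → ι → Derivation ℂ R R) : Prop where
  zero : ∀ i j, ¬ r i j → U i j = 0
  ibp : ∀ i j P, r i j → E (U i j * P) = v * E (d i j P)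
  derivU : ∀ i j k l, d i j (U k l) = 0
  derivV : ∀ i j k l, r i j → d i j (V k l) = if k = j ∧ l = i then 1 else 0

variable {E : R →ₗ[ℂ] ℂ} {v : ℂ} {U V : Matrix ι ι R} {r : ι → ι → Prop}
  {d : ι → ι → Derivation ℂ R R}

omit [DecidableEq ι] in
lemma derivation_matrix_mul (D : Derivation ℂ R R) (M N : Matrix ι ι R) :
    (M * N).map D = M.map D * N + M * N.map D := by
  ext i j
  simp only [Matrix.map_apply, Matrix.mul_apply, Matrix.add_apply, map_sum, Derivation.leibniz,
    smul_eq_mul, ← Finset.sum_add_distrib]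
  refine Finset.sum_congr rfl fun k _ => ?_
  ring

omit [Fintype ι] in
lemma derivation_matrix_one (D : Derivation ℂ R R) :
    (1 : Matrix ι ι R).map D = 0 := by
  ext i j
  by_cases h : i = j <;> simp [h]

/-- The derivation kills U and turns V into a matrix unit, so the Leibniz rule cuts the word once at
each V. -/
lemma IBPPair.map_UV_pow (h : IBPPair E v U V r d) {i j : ι} (hr : r i j) (q : ℕ) :
    ((U * V) ^ q).map (d i j) =
      ∑ k ∈ Finset.range q, (U * V) ^ k * U * Matrix.single j i 1 * (U * V) ^ (q - 1 - k) := by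
  have hU : U.map (d i j) = 0 := by ext k l; exact h.derivU i j k l
  have hV : V.map (d i j) = Matrix.single j i 1 := by
    ext k l
    rw [Matrix.map_apply, h.derivV i j k l hr, Matrix.single_apply]
    simp only [eq_comm]
  induction q with
  | zero => simp [derivation_matrix_one]
  | succ q ih =>
    rw [pow_succ', derivation_matrix_mul, derivation_matrix_mul, hU, hV, ih, zero_mul, zero_add,
      Finset.sum_range_succ', Finset.mul_sum]
    rw [add_comm]
    congr 1
    · refine Finset.sum_congr rfl fun k hk => ?_
      rw [show q + 1 - 1 - (k + 1) = q - 1 - k by omega, pow_succ']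
      simp only [mul_assoc]
    · simp

omit [Algebra ℂ R] in
lemma mul_pow_mul_comm (V U : Matrix ι ι R) (k : ℕ) : V * (U * V) ^ k = (V * U) ^ k * V := by
  induction k with
  | zero => simp
  | succ k ih => rw [pow_succ, pow_succ, ← mul_assoc, ih]; simp only [mul_assoc]

/-- Here the word begins with V, so what stands to the left of a cut is a power of VU. This is how
the diagonal entries of TT* enter the equation for T*T, and conversely. -/
lemma IBPPair.map_V_UV_pow (h : IBPPair E v U V r d) {i j : ι} (hr : r i j) (p : ℕ) :
    (V * (U * V) ^ p).map (d i j) =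
      ∑ k ∈ Finset.range (p + 1), (V * U) ^ k * Matrix.single j i 1 * (U * V) ^ (p - k) := by
  have hV : V.map (d i j) = Matrix.single j i 1 := by
    ext k l
    rw [Matrix.map_apply, h.derivV i j k l hr, Matrix.single_apply]
    simp only [eq_comm]
  rw [derivation_matrix_mul, hV, h.map_UV_pow hr, Finset.sum_range_succ', Finset.mul_sum, add_comm]
  congr 1
  · refine Finset.sum_congr rfl fun k _ => ?_
    rw [show p - (k + 1) = p - 1 - k by omega]
    rw [pow_succ, ← mul_assoc, ← mul_assoc, ← mul_assoc, mul_pow_mul_comm V U k]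
    simp only [mul_assoc]
  · simp

omit [Algebra ℂ R] in
lemma mul_single_mul_apply (M N : Matrix ι ι R) (a b i j : ι) :
    (M * Matrix.single j i (1 : R) * N : Matrix ι ι R) a b = M a j * N i b := by
  rw [mul_assoc, Matrix.mul_apply]
  rw [Finset.sum_eq_single j]
  · congr 1
    rw [Matrix.mul_apply, Finset.sum_eq_single i]
    · simp
    · intro k _ hk; simp [hk.symm]
    · simp
  · intro k _ hk
    rw [Matrix.mul_apply, Finset.sum_eq_zero, mul_zero]
    intro l _; simp [hk.symm]
  · simp

/-- The loop equation. -/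
lemma IBPPair.loop [DecidableRel r] (h : IBPPair E v U V r d) (i : ι) (p : ℕ) (Q : R) :
    E (((U * V) ^ (p + 1)) i i * Q) =
      v * ∑ j with r i j, ((∑ k ∈ Finset.range (p + 1),
        E (((V * U) ^ k) j j * ((U * V) ^ (p - k)) i i * Q)) +
        E ((V * (U * V) ^ p) j i * d i j Q)) := by
  -- The leftmost factor U i j is detached and integrated by parts against the product of the
  -- remaining word and Q.
  rw [pow_succ', mul_assoc, Matrix.mul_apply, Finset.sum_mul, map_sum, Finset.mul_sum,
    Finset.sum_filter]
  refine Finset.sum_congr rfl fun j _ => ?_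
  split_ifs with hr
  · rw [mul_assoc, h.ibp i j _ hr, Derivation.leibniz, map_add, ← map_sum]
    have := congrFun (congrFun (h.map_V_UV_pow hr p) j) i
    rw [Matrix.map_apply, Matrix.sum_apply] at this
    rw [this, smul_eq_mul, smul_eq_mul, add_comm, Finset.mul_sum]
    simp only [mul_single_mul_apply]
    congr 3
    refine Finset.sum_congr rfl fun k _ => ?_
    ring
  · rw [h.zero i j hr, zero_mul, zero_mul, map_zero]

lemma IBPPair.deriv_diag (h : IBPPair E v U V r d) {i j : ι} (hr : r i j) (q : ℕ) :
    d i j (((U * V) ^ q) i i) =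
      ∑ k ∈ Finset.range q, ((U * V) ^ k * U) i j * ((U * V) ^ (q - 1 - k)) i i := by
  have := congrFun (congrFun (h.map_UV_pow hr q) i) i
  rw [Matrix.map_apply, Matrix.sum_apply] at this
  rw [this]
  simp only [mul_single_mul_apply]

end Loop

end FreeProb
end

noncomputable section
namespace FreeProb
open Complex
open scoped ComplexOrder

/-! ### Spectral inequalities -/

section Spectral
variable {ι : Type*} [Fintype ι] [DecidableEq ι]

/-- The spectral measure of H at the i-th basis vector: one discrete probability measure on [0, ∞)
has all the (H^p)_ii as its moments. -/
lemma exists_spectral_weights {H : Matrix ι ι ℂ} (hH : H.PosSemidef) (i : ι) :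
    ∃ m w : ι → ℝ, (∀ k, 0 ≤ m k) ∧ (∀ k, 0 ≤ w k) ∧ (∑ k, w k = 1) ∧
      ∀ p : ℕ, (H ^ p) i i = ((∑ k, w k * m k ^ p : ℝ) : ℂ) := by
  set u := hH.1.eigenvectorUnitary with hu
  have key : ∀ p : ℕ, (H ^ p) i i =
      ((∑ k, ‖(u : Matrix ι ι ℂ) i k‖ ^ 2 * hH.1.eigenvalues k ^ p : ℝ) : ℂ) := by
    intro p
    conv_lhs => rw [hH.1.spectral_theorem, ← map_pow, Unitary.conjStarAlgAut_apply,
      Matrix.diagonal_pow, Matrix.mul_apply]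
    push_cast
    refine Finset.sum_congr rfl fun k _ => ?_
    rw [Matrix.mul_diagonal, Matrix.star_apply, ← Complex.mul_conj']
    simp only [Pi.pow_apply, Function.comp_apply, RCLike.star_def, ← hu]
    simp only [Complex.coe_algebraMap]
    ring
  refine ⟨hH.1.eigenvalues, fun k => ‖(u : Matrix ι ι ℂ) i k‖ ^ 2, fun k => hH.eigenvalues_nonneg k,
    fun k => by positivity, ?_, key⟩
  have := key 0
  simp only [pow_zero, Matrix.one_apply_eq, mul_one] at this
  exact_mod_cast this.symm

lemma pow_mul_pow_le {x y : ℝ} (hx : 0 ≤ x) (hy : 0 ≤ y) (r s : ℕ) :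
    x ^ r * y ^ s ≤ x ^ (r + s) + y ^ (r + s) := by
  rcases le_total x y with h | h
  · calc x ^ r * y ^ s ≤ y ^ r * y ^ s := by gcongr
      _ = y ^ (r + s) := (pow_add _ _ _).symm
      _ ≤ _ := le_add_of_nonneg_left (by positivity)
  · calc x ^ r * y ^ s ≤ x ^ r * x ^ s := by gcongr
      _ = x ^ (r + s) := (pow_add _ _ _).symm
      _ ≤ _ := le_add_of_nonneg_right (by positivity)

/-- The pointwise bound x^r y^s ≤ x^(r+s) + y^(r+s) is integrated against the product of two
spectral measures. It reduces products of diagonal entries to single entries, so that moment bounds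
need no control of operator norms. -/
lemma diag_pow_mul_le {G H : Matrix ι ι ℂ} (hG : G.PosSemidef) (hH : H.PosSemidef) (i j : ι)
    (r s : ℕ) : ((G ^ r) i i).re * ((H ^ s) j j).re ≤
      ((G ^ (r + s)) i i).re + ((H ^ (r + s)) j j).re := by
  obtain ⟨m, w, hm, hw, hw1, h⟩ := exists_spectral_weights hG i
  obtain ⟨m', w', hm', hw', hw1', h'⟩ := exists_spectral_weights hH j
  simp only [h, h', Complex.ofReal_re]
  have e1 : ∑ k, w k * m k ^ (r + s) = ∑ k, ∑ l, w k * w' l * m k ^ (r + s) := by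
    refine Finset.sum_congr rfl fun k _ => ?_
    rw [← Finset.sum_mul, ← Finset.mul_sum, hw1', mul_one]
  have e2 : ∑ l, w' l * m' l ^ (r + s) = ∑ k, ∑ l, w k * w' l * m' l ^ (r + s) := by
    rw [Finset.sum_comm]
    refine Finset.sum_congr rfl fun k _ => ?_
    rw [← Finset.sum_mul, ← Finset.sum_mul, hw1, one_mul]
  rw [e1, e2, ← Finset.sum_add_distrib, Finset.sum_mul_sum]
  refine Finset.sum_le_sum fun k _ => ?_
  rw [← Finset.sum_add_distrib]
  refine Finset.sum_le_sum fun l _ => ?_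
  have := mul_le_mul_of_nonneg_left (pow_mul_pow_le (hm k) (hm' l) r s)
    (mul_nonneg (hw k) (hw' l))
  linarith

end Spectral

/-! ### The triangular gaussian matrix over the polynomial ring -/

/-- The generic matrix `T*` (for `false`) or `T` (for `true`) over the polynomial ring. -/
def genMat (n : ℕ) : Bool → Matrix (Fin n) (Fin n) (GPoly (Fin n × Fin n))
  | false => Matrix.of fun i j => if j < i then MvPolynomial.X (Sum.inr (j, i)) else 0
  | true => Matrix.of fun i j => if i < j then MvPolynomial.X (Sum.inl (i, j)) else 0

/-- The entries `(i, j)` of `T*` (for `false`) or `T` (for `true`) that do not vanish. -/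
def genRel (n : ℕ) (b : Bool) (i j : Fin n) : Prop := if b then i < j else j < i

instance (n : ℕ) (b : Bool) : DecidableRel (genRel n b) := fun i j => by
  unfold genRel; infer_instance

/-- The derivation used when integrating by parts the `(i, j)` entry. -/
def genDer (n : ℕ) (b : Bool) (i j : Fin n) :
    Derivation ℂ (GPoly (Fin n × Fin n)) (GPoly (Fin n × Fin n)) :=
  if b then MvPolynomial.pderiv (Sum.inr (i, j)) else MvPolynomial.pderiv (Sum.inl (j, i))

/-- The Boolean treats T*T and TT* together, since the loop equation of either one involves the
other. The entry conj z_a integrates by parts into ∂/∂z_a, and z_a into the derivative with respect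
to conj z_a. -/
lemma ibpPair_genMat (n : ℕ) (s : NNReal) (b : Bool) :
    IBPPair (gexp s) s (genMat n b) (genMat n !b) (genRel n b) (genDer n b) := by
  cases b
  · refine ⟨fun i j h => ?_, fun i j P h => ?_, fun i j k l => ?_, fun i j k l h => ?_⟩
    · simp only [genRel, Bool.false_eq_true, if_false] at h
      simp [genMat, h]
    · simp only [genRel, Bool.false_eq_true, if_false] at h
      simp only [genMat, Matrix.of_apply, h, if_true, genDer, Bool.false_eq_true, if_false]
      exact gexp_X_inr_mul s _ P
    · simp only [genMat, genDer, Matrix.of_apply, Bool.false_eq_true, if_false]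
      split_ifs <;> simp [MvPolynomial.pderiv_X]
    · simp only [genRel, Bool.false_eq_true, if_false] at h
      simp only [genMat, genDer, Matrix.of_apply, Bool.false_eq_true, if_false, Bool.not_false]
      by_cases hkl : k = j ∧ l = i
      · obtain ⟨rfl, rfl⟩ := hkl
        simp [h]
      · have : (Sum.inl (j, i) : Fin n × Fin n ⊕ Fin n × Fin n) ≠ Sum.inl (k, l) := by
          intro h; apply hkl; simpa [eq_comm] using h
        rw [if_neg hkl]
        split_ifs
        · rw [MvPolynomial.pderiv_X_of_ne this.symm]
        · simp
  · refine ⟨fun i j h => ?_, fun i j P h => ?_, fun i j k l => ?_, fun i j k l h => ?_⟩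
    · simp only [genRel, if_true] at h
      simp [genMat, h]
    · simp only [genRel, if_true] at h
      simp only [genMat, Matrix.of_apply, h, if_true, genDer]
      exact gexp_X_inl_mul s _ P
    · simp only [genMat, genDer, Matrix.of_apply, if_true]
      split_ifs <;> simp [MvPolynomial.pderiv_X]
    · simp only [genRel, if_true] at h
      simp only [genMat, genDer, Matrix.of_apply, if_true, Bool.not_true]
      by_cases hkl : k = j ∧ l = i
      · obtain ⟨rfl, rfl⟩ := hkl
        simp [h]
      · have : (Sum.inr (i, j) : Fin n × Fin n ⊕ Fin n × Fin n) ≠ Sum.inr (l, k) := by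
          intro h; apply hkl
          simp only [Sum.inr.injEq, Prod.mk.injEq] at h; exact ⟨h.2.symm, h.1.symm⟩
        rw [if_neg hkl]
        split_ifs
        · rw [MvPolynomial.pderiv_X_of_ne this.symm]
        · simp

/-- The matrix `T*` (for `false`) or `T` (for `true`) at a sample point. -/
def evMat (n : ℕ) (ω : Fin n × Fin n → ℂ) (b : Bool) : Matrix (Fin n) (Fin n) ℂ :=
  (genMat n b).map (evalAt ω)

lemma evMat_true (n : ℕ) (ω : Fin n × Fin n → ℂ) :
    evMat n ω true = Matrix.of fun i j => if i < j then ω (i, j) else 0 := by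
  ext i j
  simp only [evMat, genMat, Matrix.map_apply, Matrix.of_apply]
  split_ifs <;> simp [evalAt]

lemma evMat_not (n : ℕ) (ω : Fin n × Fin n → ℂ) (b : Bool) :
    evMat n ω (!b) = (evMat n ω b).conjTranspose := by
  have h : evMat n ω false = (evMat n ω true).conjTranspose := by
    ext i j
    rw [evMat_true]
    simp only [evMat, genMat, Matrix.map_apply, Matrix.of_apply, Matrix.conjTranspose_apply]
    split_ifs <;> simp [evalAt]
  cases b
  · simp [h]
  · simp [h]

/-- The diagonal entries of `(T* T) ^ p` (for `false`) or `(T T*) ^ p` (for `true`). -/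
def diagEntry (n : ℕ) (b : Bool) (p : ℕ) (i : Fin n) (ω : Fin n × Fin n → ℂ) : ℝ :=
  (((evMat n ω b * evMat n ω !b) ^ p) i i).re

lemma posSemidef_evMat (n : ℕ) (ω : Fin n × Fin n → ℂ) (b : Bool) :
    (evMat n ω b * evMat n ω !b).PosSemidef := by
  rw [evMat_not]; exact Matrix.posSemidef_self_mul_conjTranspose _

lemma ofReal_diagEntry (n : ℕ) (b : Bool) (p : ℕ) (i : Fin n) (ω : Fin n × Fin n → ℂ) :
    (diagEntry n b p i ω : ℂ) = ((evMat n ω b * evMat n ω !b) ^ p) i i := by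
  obtain ⟨m, w, -, -, -, h⟩ := exists_spectral_weights (posSemidef_evMat n ω b) i
  rw [diagEntry, h, Complex.ofReal_re]

lemma diagEntry_nonneg (n : ℕ) (b : Bool) (p : ℕ) (i : Fin n) (ω : Fin n × Fin n → ℂ) :
    0 ≤ diagEntry n b p i ω := by
  obtain ⟨m, w, hm, hw, -, h⟩ := exists_spectral_weights (posSemidef_evMat n ω b) i
  rw [diagEntry, h, Complex.ofReal_re]
  exact Finset.sum_nonneg fun k _ => mul_nonneg (hw k) (pow_nonneg (hm k) _)

lemma diagEntry_zero (n : ℕ) (b : Bool) (i : Fin n) (ω : Fin n × Fin n → ℂ) :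
    diagEntry n b 0 i ω = 1 := by
  simp [diagEntry]

lemma diagEntry_mul_le (n : ℕ) (b b' : Bool) (r s : ℕ) (i j : Fin n) (ω : Fin n × Fin n → ℂ) :
    diagEntry n b r i ω * diagEntry n b' s j ω ≤
      diagEntry n b (r + s) i ω + diagEntry n b' (r + s) j ω :=
  diag_pow_mul_le (posSemidef_evMat n ω b) (posSemidef_evMat n ω b') i j r s

lemma map_evalAt_mul_pow (n : ℕ) (b : Bool) (p : ℕ) (ω : Fin n × Fin n → ℂ) :
    ((genMat n b * genMat n !b) ^ p).map (evalAt ω) = (evMat n ω b * evMat n ω !b) ^ p := by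
  have := map_pow ((evalAt ω).mapMatrix (m := Fin n)) (genMat n b * genMat n !b) p
  rw [map_mul] at this
  exact this

lemma evalAt_diag (n : ℕ) (b : Bool) (p : ℕ) (i : Fin n) (ω : Fin n × Fin n → ℂ) :
    evalAt ω (((genMat n b * genMat n !b) ^ p) i i) = diagEntry n b p i ω := by
  rw [ofReal_diagEntry, ← map_evalAt_mul_pow, Matrix.map_apply]

/-- The law of the entries. -/
def entryMeasure (n : ℕ) (s : NNReal) : Measure (Fin n × Fin n → ℂ) :=
  Measure.pi fun _ => complexGaussian s

instance (n : ℕ) (s : NNReal) : IsProbabilityMeasure (entryMeasure n s) := by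
  unfold entryMeasure; infer_instance

/-- Real functions given by polynomials in the entries and their conjugates. -/
def IsGPoly {n : ℕ} (f : (Fin n × Fin n → ℂ) → ℝ) : Prop :=
  ∃ P : GPoly (Fin n × Fin n), ∀ ω, evalAt ω P = f ω

namespace IsGPoly
variable {n : ℕ} {f g : (Fin n × Fin n → ℂ) → ℝ}

lemma add (hf : IsGPoly f) (hg : IsGPoly g) : IsGPoly fun ω => f ω + g ω := by
  obtain ⟨P, hP⟩ := hf
  obtain ⟨Q, hQ⟩ := hg
  exact ⟨P + Q, fun ω => by simp [hP, hQ]⟩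

lemma sub (hf : IsGPoly f) (hg : IsGPoly g) : IsGPoly fun ω => f ω - g ω := by
  obtain ⟨P, hP⟩ := hf
  obtain ⟨Q, hQ⟩ := hg
  exact ⟨P - Q, fun ω => by simp [hP, hQ]⟩

lemma mul (hf : IsGPoly f) (hg : IsGPoly g) : IsGPoly fun ω => f ω * g ω := by
  obtain ⟨P, hP⟩ := hf
  obtain ⟨Q, hQ⟩ := hg
  exact ⟨P * Q, fun ω => by simp [hP, hQ]⟩

lemma const (c : ℝ) : IsGPoly (n := n) fun _ => c :=
  ⟨MvPolynomial.C (c : ℂ), fun ω => by simp [evalAt]⟩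

lemma pow (hf : IsGPoly f) (k : ℕ) : IsGPoly fun ω => f ω ^ k := by
  obtain ⟨P, hP⟩ := hf
  exact ⟨P ^ k, fun ω => by simp [hP]⟩

lemma diagEntry (b : Bool) (p : ℕ) (i : Fin n) : IsGPoly (diagEntry n b p i) :=
  ⟨_, evalAt_diag n b p i⟩

/-- All functions in the concentration argument are polynomials in gaussian variables, and this
settles their integrability. -/
lemma integrable (hf : IsGPoly f) (s : NNReal) : Integrable f (entryMeasure n s) := by
  obtain ⟨P, hP⟩ := hf
  have := (integrable_evalAt s P).re
  refine this.congr (ae_of_all _ fun ω => ?_)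
  simp [hP]

end IsGPoly

end FreeProb
end

noncomputable section
namespace FreeProb

/-! ### Abel polynomials -/

/-- The normalized Abel polynomials `x (x + p) ^ (p - 1) / p!`. -/
def abelPoly : ℕ → ℝ → ℝ
  | 0, _ => 1
  | p + 1, x => x * (x + (p + 1)) ^ p / (p + 1).factorial

lemma abelPoly_zero (x : ℝ) : abelPoly 0 x = 1 := rfl

lemma abelPoly_succ (p : ℕ) (x : ℝ) :
    abelPoly (p + 1) x = x * (x + (p + 1)) ^ p / (p + 1).factorial := rfl

lemma abelPoly_succ_apply_zero (p : ℕ) : abelPoly (p + 1) 0 = 0 := by simp [abelPoly]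

/-- This rule, together with A_0 = 1 and A_{p+1}(0) = 0, determines the sequence; it is the only
property of the formula that the binomial identity and the Riemann sums use. -/
lemma hasDerivAt_abelPoly (p : ℕ) (x : ℝ) :
    HasDerivAt (abelPoly (p + 1)) (abelPoly p (x + 1)) x := by
  have h : HasDerivAt (fun x : ℝ => x * (x + (p + 1)) ^ p / (p + 1).factorial)
      ((1 * (x + (p + 1)) ^ p + x * (p * (x + (p + 1)) ^ (p - 1) * 1)) / (p + 1).factorial) x :=
    ((hasDerivAt_id' x).fun_mul (((hasDerivAt_id' x).add_const _).fun_pow p)).div_const _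
  refine h.congr_deriv ?_
  cases p with
  | zero => simp [abelPoly]
  | succ p =>
    rw [abelPoly_succ]
    rw [Nat.factorial_succ (p + 1)]
    have : ((p + 1).factorial : ℝ) ≠ 0 := by positivity
    push_cast
    have h2 : ((p : ℝ) + 1 + 1) ≠ 0 := by positivity
    field_simp
    ring

lemma differentiable_abelPoly (p : ℕ) : Differentiable ℝ (abelPoly p) := by
  cases p with
  | zero => exact differentiable_const _
  | succ p => exact fun x => (hasDerivAt_abelPoly p x).differentiableAt

lemma continuous_abelPoly (p : ℕ) : Continuous (abelPoly p) :=
  (differentiable_abelPoly p).continuous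

/-- The Abel polynomials form a sequence of binomial type. -/
lemma sum_abelPoly_mul (p : ℕ) (x y : ℝ) :
    ∑ k ∈ Finset.range (p + 1), abelPoly k x * abelPoly (p - k) y = abelPoly p (x + y) := by
  induction p generalizing x y with
  | zero => simp [abelPoly_zero]
  | succ p ih =>
    -- In x, the two sides have the same derivative by the identity of order p at (x + 1, y), and
    -- they agree at x = 0.
    have hd : ∀ x, HasDerivAt (fun x => (∑ k ∈ Finset.range (p + 1 + 1),
        abelPoly k x * abelPoly (p + 1 - k) y) - abelPoly (p + 1) (x + y)) 0 x := by
      intro x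
      have h1 : HasDerivAt (fun x => ∑ k ∈ Finset.range (p + 1),
          abelPoly (k + 1) x * abelPoly (p + 1 - (k + 1)) y)
          (∑ k ∈ Finset.range (p + 1), abelPoly k (x + 1) * abelPoly (p + 1 - (k + 1)) y) x :=
        HasDerivAt.fun_sum fun k _ => (hasDerivAt_abelPoly k x).mul_const _
      have h2 : HasDerivAt (fun x => abelPoly (p + 1) (x + y)) (abelPoly p (x + y + 1)) x :=
        (hasDerivAt_abelPoly p (x + y)).comp_add_const x y
      have h3 := (h1.add_const (abelPoly (p + 1) y)).fun_sub h2
      simp only [Finset.sum_range_succ' _ (p + 1), abelPoly_zero, one_mul, tsub_zero]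
      refine h3.congr_deriv ?_
      simp only [Nat.add_sub_add_right]
      rw [ih, add_right_comm, sub_self]
    have hc := is_const_of_deriv_eq_zero (fun x => (hd x).differentiableAt)
      (fun x => (hd x).deriv) x 0
    have h0 : (∑ k ∈ Finset.range (p + 1 + 1),
        abelPoly k 0 * abelPoly (p + 1 - k) y) - abelPoly (p + 1) (0 + y) = 0 := by
      rw [Finset.sum_range_succ', Finset.sum_eq_zero]
      · simp [abelPoly_zero]
      · intro k _
        rw [abelPoly_succ_apply_zero, zero_mul]
    rw [h0] at hc
    linarith

/-- The binomial identity for -x + x = 0, solved for its term of index 0. Since -A_{k+1}(-x) = ∫_0^x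
A_k(1-t) dt, this is the limit of the loop equations. -/
lemma sum_neg_abelPoly_mul (p : ℕ) (x : ℝ) :
    ∑ k ∈ Finset.range (p + 1), -abelPoly (k + 1) (-x) * abelPoly (p - k) x =
      abelPoly (p + 1) x := by
  have h := sum_abelPoly_mul (p + 1) (-x) x
  rw [neg_add_cancel, abelPoly_succ_apply_zero, Finset.sum_range_succ'] at h
  simp only [Nat.add_sub_add_right, abelPoly_zero, one_mul, tsub_zero] at h
  simp only [neg_mul, Finset.sum_neg_distrib]
  linarith

/-- The left side is ∫_0^1 A_p, hence the limit of the normalized trace. -/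
lemma abelPoly_succ_neg_one (p : ℕ) :
    -abelPoly (p + 1) (-1) = (p : ℝ) ^ p / (p + 1).factorial := by
  rw [abelPoly_succ]
  ring

/-- Quadratic error of the first order approximation of an antiderivative. -/
lemma exists_taylor_bound (k : ℕ) : ∃ L, 0 ≤ L ∧ ∀ x ∈ Set.Icc (0 : ℝ) 1, ∀ y ∈ Set.Icc (0 : ℝ) 1,
    |abelPoly (k + 1) (y - 1) - abelPoly (k + 1) (x - 1) - (y - x) * abelPoly k x| ≤
      L * (y - x) ^ 2 := by
  obtain ⟨L, hL⟩ : ∃ L, ∀ x ∈ Set.Icc (0 : ℝ) 1, ‖deriv (abelPoly k) x‖ ≤ L := by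
    have hc : Continuous (deriv (abelPoly k)) := by
      cases k with
      | zero =>
        have : abelPoly 0 = fun _ => (1 : ℝ) := rfl
        rw [this]; simp only [deriv_const']; exact continuous_const
      | succ k =>
        have : deriv (abelPoly (k + 1)) = fun x => abelPoly k (x + 1) :=
          funext fun x => (hasDerivAt_abelPoly k x).deriv
        rw [this]
        exact (continuous_abelPoly k).comp (by fun_prop)
    exact isCompact_Icc.exists_bound_of_continuousOn hc.continuousOn
  have hL0 : 0 ≤ L := (norm_nonneg _).trans (hL 0 (by simp))
  refine ⟨L, hL0, fun x hx y hy => ?_⟩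
  have hlip : ∀ t ∈ Set.Icc (0 : ℝ) 1, ‖abelPoly k t - abelPoly k x‖ ≤ L * ‖t - x‖ := fun t ht =>
    Convex.norm_image_sub_le_of_norm_deriv_le (fun z _ => differentiable_abelPoly k z) hL
      (convex_Icc 0 1) hx ht
  have hseg : Set.uIcc x y ⊆ Set.Icc 0 1 := Set.uIcc_subset_Icc hx hy
  have h := Convex.norm_image_sub_le_of_norm_hasDerivWithin_le
    (f := fun t => abelPoly (k + 1) (t - 1) - t * abelPoly k x)
    (f' := fun t => abelPoly k t - abelPoly k x) (s := Set.uIcc x y) (C := L * |y - x|)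
    (fun t ht => by
      have h1 : HasDerivAt (fun t => abelPoly (k + 1) (t - 1)) (abelPoly k (t - 1 + 1)) t :=
        (hasDerivAt_abelPoly k (t - 1)).comp_sub_const t 1
      rw [sub_add_cancel] at h1
      have h2 := (hasDerivAt_id' t).mul_const (abelPoly k x)
      rw [one_mul] at h2
      exact (h1.fun_sub h2).hasDerivWithinAt)
    (fun t ht => (hlip t (hseg ht)).trans (by
      gcongr
      rw [Real.norm_eq_abs]
      exact Set.abs_sub_left_of_mem_uIcc ht))
    (convex_uIcc x y) Set.left_mem_uIcc Set.right_mem_uIcc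
  simp only [Real.norm_eq_abs] at h
  rw [mul_assoc, abs_mul_abs_self, ← pow_two] at h
  convert h using 2
  ring

lemma exists_abelPoly_bound (p : ℕ) : ∃ B, 0 ≤ B ∧ ∀ k ≤ p, ∀ x ∈ Set.Icc (-1 : ℝ) 1,
    |abelPoly k x| ≤ B := by
  have h : ∀ k, ∃ B, ∀ x ∈ Set.Icc (-1 : ℝ) 1, ‖abelPoly k x‖ ≤ B := fun k =>
    isCompact_Icc.exists_bound_of_continuousOn (continuous_abelPoly k).continuousOn
  choose B hB using h
  refine ⟨∑ k ∈ Finset.range (p + 1), |B k|, Finset.sum_nonneg fun k _ => abs_nonneg _,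
    fun k hk x hx => (hB k x hx).trans ((le_abs_self _).trans ?_)⟩
  exact Finset.single_le_sum (f := fun k => |B k|) (fun i _ => abs_nonneg _)
    (Finset.mem_range.2 (by omega))

/-- The limits of the diagonal entries of `(T* T) ^ p` and `(T T*) ^ p` at height `x`. -/
def diagLimit (b : Bool) (p : ℕ) (x : ℝ) : ℝ := abelPoly p (if b then 1 - x else x)

lemma div_mem_unit {n : ℕ} {j : ℕ} (hj : j ≤ n) : (j : ℝ) / n ∈ Set.Icc (0 : ℝ) 1 :=
  ⟨by positivity, div_le_one_of_le₀ (by exact_mod_cast hj) (by positivity)⟩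

/-- Riemann sums of Abel polynomials. -/
lemma exists_riemann_bound (k : ℕ) : ∃ L, 0 ≤ L ∧ ∀ n : ℕ, 0 < n → ∀ a b : ℕ, a ≤ b → b ≤ n →
    |(n : ℝ)⁻¹ * ∑ j ∈ Finset.Ico a b, abelPoly k (j / n) -
      (abelPoly (k + 1) (b / n - 1) - abelPoly (k + 1) (a / n - 1))| ≤ L / n ∧
    |(n : ℝ)⁻¹ * ∑ j ∈ Finset.Ico a b, abelPoly k (1 - j / n) -
      (abelPoly (k + 1) (-(a / n)) - abelPoly (k + 1) (-(b / n)))| ≤ L / n := by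
  obtain ⟨L, hL0, hL⟩ := exists_taylor_bound k
  refine ⟨L, hL0, fun n hn a b hab hbn => ?_⟩
  have hn' : (0 : ℝ) < n := by exact_mod_cast hn
  have htel : ∀ F : ℕ → ℝ, F b - F a = ∑ j ∈ Finset.Ico a b, (F (j + 1) - F j) := fun F =>
    (Finset.sum_Ico_sub F hab).symm
  have hcount : ∑ j ∈ Finset.Ico a b, L * (1 / n : ℝ) ^ 2 ≤ L / n := by
    rw [Finset.sum_const, Nat.card_Ico, nsmul_eq_mul]
    have : ((b - a : ℕ) : ℝ) ≤ n := by exact_mod_cast (by omega : b - a ≤ n)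
    calc ((b - a : ℕ) : ℝ) * (L * (1 / n : ℝ) ^ 2) ≤ n * (L * (1 / n : ℝ) ^ 2) := by gcongr
      _ = L / n := by field_simp
  have hmem : ∀ j ∈ Finset.Ico a b, (j : ℝ) / n ∈ Set.Icc (0 : ℝ) 1 ∧
      ((j + 1 : ℕ) : ℝ) / n ∈ Set.Icc (0 : ℝ) 1 := fun j hj => by
    rw [Finset.mem_Ico] at hj
    exact ⟨div_mem_unit (by omega), div_mem_unit (by omega)⟩
  constructor
  · rw [htel (fun j => abelPoly (k + 1) (j / n - 1)), Finset.mul_sum, ← Finset.sum_sub_distrib]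
    refine (Finset.abs_sum_le_sum_abs _ _).trans ((Finset.sum_le_sum fun j hj => ?_).trans hcount)
    have h := hL _ (hmem j hj).1 _ (hmem j hj).2
    have e : ((j + 1 : ℕ) : ℝ) / n - j / n = 1 / n := by push_cast; ring
    rw [e] at h
    rw [abs_sub_comm]
    rw [inv_eq_one_div]
    exact h
  · have := htel (fun j => -abelPoly (k + 1) (-(j / n)))
    rw [neg_sub_neg] at this
    rw [this, Finset.mul_sum, ← Finset.sum_sub_distrib]
    refine (Finset.abs_sum_le_sum_abs _ _).trans ((Finset.sum_le_sum fun j hj => ?_).trans hcount)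
    -- The Taylor bound is used at the reflected points 1 - j/n and 1 - (j+1)/n.
    have hs : ∀ x : ℝ, x ∈ Set.Icc (0 : ℝ) 1 → 1 - x ∈ Set.Icc (0 : ℝ) 1 := fun x hx =>
      ⟨by linarith [hx.2], by linarith [hx.1]⟩
    have h := hL _ (hs _ (hmem j hj).1) _ (hs _ (hmem j hj).2)
    have e : (1 - ((j + 1 : ℕ) : ℝ) / n) - (1 - j / n) = -(1 / n) := by push_cast; ring
    rw [e, neg_sq] at h
    have e1 : ∀ x : ℝ, 1 - x - 1 = -x := fun x => by ring
    rw [e1, e1] at h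
    rw [inv_eq_one_div]
    refine le_of_eq_of_le (congrArg _ ?_) h
    ring

/-- The limiting recursion for the diagonal entries, as a Riemann sum. -/
lemma exists_recursion_bound (p : ℕ) : ∃ C, 0 ≤ C ∧ ∀ n : ℕ, 0 < n → ∀ (b : Bool) (i : Fin n),
    |(n : ℝ)⁻¹ * ∑ j with genRel n b i j, ∑ k ∈ Finset.range (p + 1),
        diagLimit (!b) k (j / n) * diagLimit b (p - k) (i / n) -
      diagLimit b (p + 1) (i / n)| ≤ C / n := by
  choose L hL0 hL using exists_riemann_bound
  obtain ⟨B, hB0, hB⟩ := exists_abelPoly_bound p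
  refine ⟨∑ k ∈ Finset.range (p + 1), (L k + B) * B, Finset.sum_nonneg fun k _ =>
    mul_nonneg (add_nonneg (hL0 k) hB0) hB0, fun n hn b i => ?_⟩
  have hn' : (0 : ℝ) < n := by exact_mod_cast hn
  set x : ℝ := if b then 1 - (i / n : ℝ) else i / n with hx
  have hi := div_mem_unit (n := n) i.2.le
  have hx01 : x ∈ Set.Icc (-1 : ℝ) 1 := by
    rw [hx]; split_ifs <;> constructor <;> linarith [hi.1, hi.2]
  -- For both values of b these are Riemann sums for ∫_0^x A_k(1-t) dt = -A_{k+1}(-x); for `true`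
  -- the substitution t ↦ 1 - t intervenes.
  have hsum : ∀ k ≤ p, |(n : ℝ)⁻¹ * ∑ j with genRel n b i j, diagLimit (!b) k (j / n) -
      -abelPoly (k + 1) (-x)| ≤ (L k + B) / n := by
    intro k hk
    cases b with
    | false =>
      have e : ∑ j : Fin n with genRel n false i j, diagLimit (!false) k (j / n) =
          ∑ j ∈ Finset.Ico 0 (i : ℕ), abelPoly k (1 - j / n) := by
        have hS : Finset.Ico 0 (i : ℕ) =
            (Finset.univ.filter fun j => genRel n false i j).map Fin.valEmbedding := by
          ext j
          simp only [Finset.mem_Ico, zero_le, true_and, Finset.mem_map, Finset.mem_filter,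
            Finset.mem_univ, genRel, Bool.false_eq_true, if_false, Fin.valEmbedding_apply]
          refine ⟨fun h => ⟨⟨j, h.trans i.2⟩, h, rfl⟩, ?_⟩
          rintro ⟨a, ha, rfl⟩
          exact ha
        rw [hS, Finset.sum_map]
        rfl
      have h := (hL k n hn 0 i (Nat.zero_le _) i.2.le).2
      rw [e]
      simp only [Nat.cast_zero, zero_div, neg_zero, abelPoly_succ_apply_zero, zero_sub] at h
      simp only [hx, Bool.false_eq_true, if_false]
      refine h.trans ?_
      gcongr; linarith
    | true =>
      -- The range j > i misses the left endpoint i of the Riemann sum; the correction is at most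
      -- B/n and accounts for the B in the constant.
      have e : ∑ j : Fin n with genRel n true i j, diagLimit (!true) k (j / n) =
          ∑ j ∈ Finset.Ico (i : ℕ) n, abelPoly k (j / n) - abelPoly k (i / n) := by
        have hS : Finset.Ico ((i : ℕ) + 1) n =
            (Finset.univ.filter fun j => genRel n true i j).map Fin.valEmbedding := by
          ext j
          simp only [Finset.mem_Ico, Finset.mem_map, Finset.mem_filter,
            Finset.mem_univ, genRel, if_true, Fin.valEmbedding_apply, true_and]
          refine ⟨fun h => ⟨⟨j, h.2⟩, Fin.lt_def.2 h.1, rfl⟩, ?_⟩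
          rintro ⟨a, ha, rfl⟩
          exact ⟨ha, a.2⟩
        rw [Finset.sum_eq_sum_Ico_succ_bot i.2, add_sub_cancel_left, hS, Finset.sum_map]
        rfl
      have h := (hL k n hn i n i.2.le le_rfl).1
      rw [e]
      have h2 := hB k hk (i / n) ⟨by linarith [hi.1], hi.2⟩
      rw [div_self hn'.ne', sub_self, abelPoly_succ_apply_zero, zero_sub] at h
      simp only [hx, if_true]
      rw [neg_sub, mul_sub, add_div]
      calc _ = |((n : ℝ)⁻¹ * ∑ j ∈ Finset.Ico (i : ℕ) n, abelPoly k (j / n) -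
          -abelPoly (k + 1) (i / n - 1)) - (n : ℝ)⁻¹ * abelPoly k (i / n)| := by congr 1; ring
        _ ≤ _ := (abs_sub _ _).trans (add_le_add h ?_)
      rw [abs_mul, abs_of_pos (inv_pos.2 hn'), div_eq_inv_mul B]
      exact mul_le_mul_of_nonneg_left h2 (inv_pos.2 hn').le
  have e1 : diagLimit b (p + 1) (i / n) = abelPoly (p + 1) x := rfl
  have e2 : ∀ k, diagLimit b k (i / n) = abelPoly k x := fun k => rfl
  rw [Finset.sum_comm, e1, ← sum_neg_abelPoly_mul, Finset.mul_sum, ← Finset.sum_sub_distrib,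
    Finset.sum_div]
  refine (Finset.abs_sum_le_sum_abs _ _).trans (Finset.sum_le_sum fun k hk => ?_)
  have hk' : k ≤ p := by rw [Finset.mem_range] at hk; omega
  rw [← Finset.sum_mul, e2, ← mul_assoc, ← sub_mul, abs_mul, mul_div_right_comm]
  exact mul_le_mul (hsum k hk') (hB _ (by omega) _ hx01) (abs_nonneg _)
    (div_nonneg (add_nonneg (hL0 k) hB0) hn'.le)

end FreeProb
end

noncomputable section
namespace FreeProb

/-! ### Concentration of the diagonal entries -/

section
variable {n : ℕ}

lemma gexp_eq_integral {s : NNReal} {f : (Fin n × Fin n → ℂ) → ℝ} {P : GPoly (Fin n × Fin n)}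
    (hP : ∀ ω, evalAt ω P = f ω) : gexp s P = ((∫ ω, f ω ∂(entryMeasure n s) : ℝ) : ℂ) := by
  rw [gexp_apply]
  simp only [hP]
  exact integral_ofReal

lemma evMat_row (b : Bool) (k : ℕ) (ω : Fin n × Fin n → ℂ) :
    evMat n ω (!b) * (evMat n ω b * evMat n ω !b) ^ k =
      ((evMat n ω b * evMat n ω !b) ^ k * evMat n ω b).conjTranspose := by
  rw [Matrix.conjTranspose_mul, Matrix.conjTranspose_pow, Matrix.conjTranspose_mul, evMat_not,
    Matrix.conjTranspose_conjTranspose]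

/-- As V = U*, the row norm squared is the (i, i) entry of (UV)^k U V (UV)^k. This bounds a whole
sum over j by one diagonal entry. -/
lemma sum_norm_sq_row (b : Bool) (k : ℕ) (i : Fin n) (ω : Fin n × Fin n → ℂ) :
    ∑ j, ‖((evMat n ω b * evMat n ω !b) ^ k * evMat n ω b) i j‖ ^ 2 =
      diagEntry n b (2 * k + 1) i ω := by
  have h : (((∑ j, ‖((evMat n ω b * evMat n ω !b) ^ k * evMat n ω b) i j‖ ^ 2 : ℝ)) : ℂ) =
      diagEntry n b (2 * k + 1) i ω := by
    rw [ofReal_diagEntry, two_mul, add_assoc, pow_add, pow_succ' _ k, mul_assoc (evMat n ω b),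
      evMat_row, ← mul_assoc, Matrix.mul_apply]
    push_cast
    refine Finset.sum_congr rfl fun j _ => ?_
    rw [Matrix.conjTranspose_apply, ← Complex.mul_conj']
    rfl
  exact_mod_cast h

lemma evalAt_mul_row (b : Bool) (k : ℕ) (i j : Fin n) (ω : Fin n × Fin n → ℂ) :
    evalAt ω (((genMat n b * genMat n !b) ^ k * genMat n b) i j) =
      ((evMat n ω b * evMat n ω !b) ^ k * evMat n ω b) i j := by
  have := map_mul ((evalAt ω).mapMatrix (m := Fin n)) ((genMat n b * genMat n !b) ^ k) (genMat n b)
  rw [map_pow ((evalAt ω).mapMatrix (m := Fin n)),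
    map_mul ((evalAt ω).mapMatrix (m := Fin n)) (genMat n b) (genMat n !b)] at this
  exact congrFun (congrFun this i) j

lemma norm_evalAt_mul_col (b : Bool) (k : ℕ) (i j : Fin n) (ω : Fin n × Fin n → ℂ) :
    ‖evalAt ω ((genMat n (!b) * (genMat n b * genMat n !b) ^ k) j i)‖ =
      ‖((evMat n ω b * evMat n ω !b) ^ k * evMat n ω b) i j‖ := by
  have := map_mul ((evalAt ω).mapMatrix (m := Fin n)) (genMat n !b) ((genMat n b * genMat n !b) ^ k)
  rw [map_pow ((evalAt ω).mapMatrix (m := Fin n)),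
    map_mul ((evalAt ω).mapMatrix (m := Fin n)) (genMat n b) (genMat n !b)] at this
  have h2 : evalAt ω ((genMat n (!b) * (genMat n b * genMat n !b) ^ k) j i) =
    (evMat n ω (!b) * (evMat n ω b * evMat n ω !b) ^ k) j i := congrFun (congrFun this j) i
  rw [h2, evMat_row, Matrix.conjTranspose_apply, norm_star]

lemma evalAt_diag_not (b : Bool) (p : ℕ) (i : Fin n) (ω : Fin n × Fin n → ℂ) :
    evalAt ω (((genMat n (!b) * genMat n b) ^ p) i i) = diagEntry n (!b) p i ω := by
  have := evalAt_diag n (!b) p i ω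
  rwa [Bool.not_not] at this

/-- The main term of the loop equation tested against `f`. -/
def loopMain (s : NNReal) (b : Bool) (p : ℕ) (i : Fin n) (f : (Fin n × Fin n → ℂ) → ℝ) : ℝ :=
  s * ∑ j with genRel n b i j, ∑ k ∈ Finset.range (p + 1),
    ∫ ω, diagEntry n (!b) k j ω * diagEntry n b (p - k) i ω * f ω ∂(entryMeasure n s)

lemma loop_real (s : NNReal) (b : Bool) (p : ℕ) (i : Fin n) {f : (Fin n × Fin n → ℂ) → ℝ}
    {Q : GPoly (Fin n × Fin n)} (hQ : ∀ ω, evalAt ω Q = f ω) :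
    ((∫ ω, diagEntry n b (p + 1) i ω * f ω ∂(entryMeasure n s) : ℝ) : ℂ) =
      loopMain s b p i f + s * ∑ j with genRel n b i j,
        gexp s ((genMat n (!b) * (genMat n b * genMat n !b) ^ p) j i * genDer n b i j Q) := by
  have h := (ibpPair_genMat n s b).loop i p Q
  rw [gexp_eq_integral (f := fun ω => diagEntry n b (p + 1) i ω * f ω)
    (fun ω => by rw [map_mul, evalAt_diag, hQ]; push_cast; rfl)] at h
  rw [h, Finset.sum_add_distrib, mul_add, loopMain]
  push_cast
  congr 2
  refine Finset.sum_congr rfl fun j _ => Finset.sum_congr rfl fun k _ => ?_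
  rw [gexp_eq_integral]
  intro ω
  rw [map_mul, map_mul, evalAt_diag, evalAt_diag_not, hQ]
  push_cast; rfl

lemma integral_diagEntry_succ (s : NNReal) (b : Bool) (p : ℕ) (i : Fin n) :
    ∫ ω, diagEntry n b (p + 1) i ω ∂(entryMeasure n s) = loopMain s b p i fun _ => 1 := by
  have h := loop_real s b p i (f := fun _ => 1) (Q := 1) (fun ω => by simp)
  simp only [Derivation.map_one_eq_zero, mul_zero, map_zero, Finset.sum_const_zero, add_zero,
    mul_one] at h
  exact_mod_cast h

/-- In the derivative term of the loop equation, j occurs only in a product of two entries of row i.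
Bounding this product by the sum of the two squares and summing over j gives row norms, so the sum
costs no factor n and the prefactor s = 1/n survives. -/
lemma abs_integral_sq_sub_loopMain_le (s : NNReal) (b : Bool) (p : ℕ) (i : Fin n) :
    |∫ ω, diagEntry n b (p + 1) i ω * diagEntry n b (p + 1) i ω ∂(entryMeasure n s) -
        loopMain s b p i (diagEntry n b (p + 1) i)| ≤
      s * ∑ k ∈ Finset.range (p + 1), ∫ ω, (diagEntry n b (2 * p + 1) i ω +
        diagEntry n b (2 * k + 1) i ω) * diagEntry n b (p - k) i ω ∂(entryMeasure n s) := by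
  have h := loop_real s b p i (f := diagEntry n b (p + 1) i) (evalAt_diag n b (p + 1) i)
  rw [← Real.norm_eq_abs, ← Complex.norm_real, Complex.ofReal_sub, h, add_sub_cancel_left, norm_mul, Complex.norm_real,
    Real.norm_of_nonneg s.coe_nonneg]
  refine mul_le_mul_of_nonneg_left ?_ s.coe_nonneg
  rw [← map_sum, gexp_apply]
  have hp : ∀ k, IsGPoly fun ω => (diagEntry n b (2 * p + 1) i ω +
        diagEntry n b (2 * k + 1) i ω) * diagEntry n b (p - k) i ω := fun k =>
    ((IsGPoly.diagEntry b _ i).add (IsGPoly.diagEntry b _ i)).mul (IsGPoly.diagEntry b _ i)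
  rw [← integral_finsetSum _ fun k _ => (hp k).integrable s]
  refine norm_integral_le_of_norm_le (integrable_finsetSum _ fun k _ => (hp k).integrable s)
    (ae_of_all _ fun ω => ?_)
  rw [map_sum]
  set Y : ℕ → Fin n → ℝ := fun k j => ‖((evMat n ω b * evMat n ω !b) ^ k * evMat n ω b) i j‖ with hY
  have hterm : ∀ j, genRel n b i j →
      ‖evalAt ω ((genMat n (!b) * (genMat n b * genMat n !b) ^ p) j i *
        genDer n b i j (((genMat n b * genMat n !b) ^ (p + 1)) i i))‖ ≤
      ∑ k ∈ Finset.range (p + 1), (Y p j ^ 2 + Y k j ^ 2) * diagEntry n b (p - k) i ω := by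
    intro j hj
    rw [(ibpPair_genMat n s b).deriv_diag hj, Finset.mul_sum, map_sum]
    refine (norm_sum_le _ _).trans (Finset.sum_le_sum fun k _ => ?_)
    rw [map_mul, map_mul, norm_mul, norm_mul, norm_evalAt_mul_col, evalAt_mul_row,
      add_tsub_cancel_right, evalAt_diag, Complex.norm_real,
      Real.norm_of_nonneg (diagEntry_nonneg _ _ _ _ _), ← mul_assoc]
    refine mul_le_mul_of_nonneg_right ?_ (diagEntry_nonneg _ _ _ _ _)
    change Y p j * Y k j ≤ _
    nlinarith [sq_nonneg (Y p j - Y k j), sq_nonneg (Y p j + Y k j)]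
  calc _ ≤ ∑ j with genRel n b i j,
        ∑ k ∈ Finset.range (p + 1), (Y p j ^ 2 + Y k j ^ 2) * diagEntry n b (p - k) i ω := by
        refine (norm_sum_le _ _).trans (Finset.sum_le_sum fun j hj => hterm j ?_)
        exact (Finset.mem_filter.1 hj).2
    _ ≤ ∑ j, ∑ k ∈ Finset.range (p + 1), (Y p j ^ 2 + Y k j ^ 2) * diagEntry n b (p - k) i ω := by
        -- All terms are nonnegative, so j may run over all columns and complete row norms appear.
        refine Finset.sum_le_sum_of_subset_of_nonneg (Finset.filter_subset _ _) fun j _ _ => ?_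
        exact Finset.sum_nonneg fun k _ => mul_nonneg (by positivity) (diagEntry_nonneg _ _ _ _ _)
    _ = _ := by
        rw [Finset.sum_comm]
        refine Finset.sum_congr rfl fun k _ => ?_
        rw [← Finset.sum_mul, Finset.sum_add_distrib]
        simp only [hY, sum_norm_sq_row]

/-- The law of the entries of the `n × n` matrix. -/
abbrev entryLaw (n : ℕ) : Measure (Fin n × Fin n → ℂ) := entryMeasure n (1 / (n : NNReal))

lemma inv_mul_sum_filter_le (hn : 0 < n) {r : Fin n → Prop} [DecidablePred r] {f : Fin n → ℝ}
    {c : ℝ} (hc : 0 ≤ c) (hf : ∀ j, |f j| ≤ c) :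
    |((1 / (n : NNReal) : NNReal) : ℝ) * ∑ j with r j, f j| ≤ c := by
  have hn' : (0 : ℝ) < n := by exact_mod_cast hn
  have h1 : |∑ j with r j, f j| ≤ n * c := by
    refine (Finset.abs_sum_le_sum_abs _ _).trans ((Finset.sum_le_sum fun j _ => hf j).trans ?_)
    rw [Finset.sum_const, nsmul_eq_mul]
    gcongr
    calc _ ≤ (Finset.univ : Finset (Fin n)).card := Finset.card_filter_le _ _
      _ = n := Finset.card_fin n
  have e : ((1 / (n : NNReal) : NNReal) : ℝ) = (n : ℝ)⁻¹ := by push_cast; rw [one_div]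
  rw [abs_mul, e, abs_of_pos (inv_pos.2 hn'), inv_mul_le_iff₀ hn']
  exact h1

/-- The loop equation with Q = 1 has p + 1 terms in k, each at most twice the bound of order p by
`diagEntry_mul_le`; hence the factor 2(p + 1) at each step. The bound is uniform in n and i. -/
lemma integral_diagEntry_le (hn : 0 < n) (p : ℕ) (b : Bool) (i : Fin n) :
    ∫ ω, diagEntry n b p i ω ∂(entryLaw n) ≤ 2 ^ p * p.factorial := by
  induction p generalizing b i with
  | zero => simp [diagEntry_zero]
  | succ p ih =>
    rw [integral_diagEntry_succ, loopMain]
    refine (le_abs_self _).trans (inv_mul_sum_filter_le hn (by positivity) fun j => ?_)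
    refine (Finset.abs_sum_le_sum_abs _ _).trans
      ((Finset.sum_le_sum (g := fun _ => 2 * (2 ^ p * (p.factorial : ℝ))) fun k hk => ?_).trans ?_)
    · have hk' : k + (p - k) = p := by rw [Finset.mem_range] at hk; omega
      rw [abs_of_nonneg (integral_nonneg fun ω => mul_nonneg (mul_nonneg (diagEntry_nonneg _ _ _ _ _)
        (diagEntry_nonneg _ _ _ _ _)) zero_le_one)]
      have h1 := (IsGPoly.diagEntry (n := n) (!b) p j).integrable (1 / (n : NNReal))
      have h2 := (IsGPoly.diagEntry (n := n) b p i).integrable (1 / (n : NNReal))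
      calc _ ≤ ∫ ω, (diagEntry n (!b) p j ω + diagEntry n b p i ω) ∂(entryLaw n) := by
            refine integral_mono ?_ (h1.add h2) fun ω => ?_
            · exact (((IsGPoly.diagEntry (!b) k j).mul (IsGPoly.diagEntry b (p - k) i)).mul
                (IsGPoly.const 1)).integrable _
            · have := diagEntry_mul_le n (!b) b k (p - k) j i ω
              rw [hk'] at this
              simpa using this
        _ ≤ _ := by
            rw [integral_add h1 h2, two_mul]
            exact add_le_add (ih _ _) (ih _ _)
    · rw [Finset.sum_const, Finset.card_range, nsmul_eq_mul, Nat.factorial_succ, pow_succ]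
      push_cast
      exact le_of_eq (by ring)

/-- Cauchy–Schwarz for polynomial functions. -/
lemma abs_integral_mul_le {f g : (Fin n × Fin n → ℂ) → ℝ} (hf : IsGPoly f) (hg : IsGPoly g)
    (s : NNReal) {a c : ℝ} (ha : ∫ ω, f ω ^ 2 ∂(entryMeasure n s) ≤ a)
    (hc : ∫ ω, g ω ^ 2 ∂(entryMeasure n s) ≤ c) :
    |∫ ω, f ω * g ω ∂(entryMeasure n s)| ≤ √a * √c := by
  set x := ∫ ω, f ω * g ω ∂(entryMeasure n s)
  set A := ∫ ω, f ω ^ 2 ∂(entryMeasure n s)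
  set C := ∫ ω, g ω ^ 2 ∂(entryMeasure n s)
  have hA : 0 ≤ A := integral_nonneg fun ω => sq_nonneg _
  have hC : 0 ≤ C := integral_nonneg fun ω => sq_nonneg _
  have key : ∀ t : ℝ, 0 ≤ A * (t * t) + (2 * x) * t + C := by
    intro t
    have h : 0 ≤ ∫ ω, (t * f ω + g ω) ^ 2 ∂(entryMeasure n s) := integral_nonneg fun ω => sq_nonneg _
    have e : ∀ ω, (t * f ω + g ω) ^ 2 = (t * t) * f ω ^ 2 + (2 * t) * (f ω * g ω) + g ω ^ 2 :=
      fun ω => by ring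
    simp only [e] at h
    have i1 := ((hf.pow 2).integrable s).const_mul (t * t)
    have i2 := ((hf.mul hg).integrable s).const_mul (2 * t)
    rw [integral_add (f := fun ω => (t * t) * f ω ^ 2 + (2 * t) * (f ω * g ω)) (i1.add i2) ((hg.pow 2).integrable s), integral_add i1 i2,
      integral_const_mul, integral_const_mul] at h
    linarith
  have hd := discrim_le_zero key
  rw [discrim] at hd
  have hx : x ^ 2 ≤ A * C := by nlinarith
  calc |x| = √(x ^ 2) := (Real.sqrt_sq_eq_abs x).symm
    _ ≤ √(a * c) := Real.sqrt_le_sqrt (hx.trans (mul_le_mul ha hc hC (hA.trans ha)))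
    _ = √a * √c := Real.sqrt_mul (hA.trans ha) _

end

end FreeProb
end

/-! ### Induction on the order: L² concentration and the limiting moments -/

noncomputable section
namespace FreeProb

/-- A bound for the `p`-th moments of the diagonal. -/
def momBound (p : ℕ) : ℝ := 2 ^ p * p.factorial

lemma momBound_mono {p q : ℕ} (h : p ≤ q) : momBound p ≤ momBound q := by
  unfold momBound
  have h1 : (p.factorial : ℝ) ≤ q.factorial := by exact_mod_cast Nat.factorial_le h
  have h2 : (2 : ℝ) ^ p ≤ 2 ^ q := pow_le_pow_right₀ one_le_two h
  gcongr

lemma one_le_momBound (p : ℕ) : 1 ≤ momBound p := by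
  simpa [momBound] using momBound_mono (Nat.zero_le p)

section
variable {n : ℕ}

lemma integral_diagEntry_mul_le (hn : 0 < n) (b : Bool) (i : Fin n) {k l m : ℕ} (h : k + l ≤ m) :
    ∫ ω, diagEntry n b k i ω * diagEntry n b l i ω ∂(entryLaw n) ≤ 2 * momBound m := by
  have h1 := (IsGPoly.diagEntry (n := n) b (k + l) i).integrable (1 / (n : NNReal))
  calc _ ≤ ∫ ω, (diagEntry n b (k + l) i ω + diagEntry n b (k + l) i ω) ∂(entryLaw n) :=
        integral_mono (((IsGPoly.diagEntry b k i).mul (IsGPoly.diagEntry b l i)).integrable _)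
          (h1.add h1) fun ω => diagEntry_mul_le n b b k l i i ω
    _ ≤ _ := by
        rw [integral_add h1 h1, two_mul]
        have := (integral_diagEntry_le hn (k + l) b i).trans (momBound_mono h)
        exact add_le_add this this

/-- The constant is 4 · 2: each of the two squares is at most twice the entry of doubled order, and
the product of the two new entries costs another 2. -/
lemma integral_diagEntry_mul_sq_le (hn : 0 < n) (b : Bool) (i : Fin n) {k l m : ℕ}
    (h : 2 * k + 2 * l ≤ m) :
    ∫ ω, (diagEntry n b k i ω * diagEntry n b l i ω) ^ 2 ∂(entryLaw n) ≤ 8 * momBound m := by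
  have h1 := (IsGPoly.diagEntry (n := n) b k i)
  have h2 := (IsGPoly.diagEntry (n := n) b l i)
  have h3 := (IsGPoly.diagEntry (n := n) b (2 * k) i)
  have h4 := (IsGPoly.diagEntry (n := n) b (2 * l) i)
  calc _ ≤ ∫ ω, 4 * (diagEntry n b (2 * k) i ω * diagEntry n b (2 * l) i ω) ∂(entryLaw n) := by
        refine integral_mono (((h1.mul h2).pow 2).integrable _)
          (((h3.mul h4).integrable _).const_mul 4) fun ω => ?_
        have e1 := diagEntry_mul_le n b b k k i i ω
        have e2 := diagEntry_mul_le n b b l l i i ω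
        rw [← two_mul, ← two_mul] at e1 e2
        have p1 := diagEntry_nonneg n b k i ω
        have p2 := diagEntry_nonneg n b l i ω
        have p3 := diagEntry_nonneg n b (2 * k) i ω
        have := mul_le_mul e1 e2 (mul_nonneg p2 p2) (by positivity)
        simp only
        nlinarith
    _ ≤ _ := by
        rw [integral_const_mul]
        linarith [integral_diagEntry_mul_le hn b i h]

/-- The main term of the limiting recursion as a Riemann sum. -/
def recSum (b : Bool) (p : ℕ) (i : Fin n) : ℝ :=
  (n : ℝ)⁻¹ * ∑ j with genRel n b i j, ∑ k ∈ Finset.range (p + 1),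
        diagLimit (!b) k (j / n) * diagLimit b (p - k) (i / n)

/-- With D, D' the two entries and a', a their limits, D D' X - a' a X = (D - a') D' X + a' (D' - a)
X, and Cauchy–Schwarz applies to each summand. Only entries of order at most p are compared with
their limits, so the induction hypothesis supplies e. -/
lemma abs_loopMain_sub_le (hn : 0 < n) (b : Bool) (p : ℕ) (i : Fin n)
    {X : (Fin n × Fin n → ℂ) → ℝ} (hX : IsGPoly X) {B e κ : ℝ} (hB : 0 ≤ B)
    (hBd : ∀ k ≤ p, ∀ b (j : Fin n), |diagLimit b k (j / n)| ≤ B)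
    (he : ∀ k ≤ p, ∀ b j, ∫ ω, (diagEntry n b k j ω - diagLimit b k (j / n)) ^ 2 ∂(entryLaw n) ≤ e)
    (hκ : ∫ ω, X ω ^ 2 ∂(entryLaw n) ≤ κ)
    (hκ' : ∀ k ≤ p, ∫ ω, (diagEntry n b k i ω * X ω) ^ 2 ∂(entryLaw n) ≤ κ) :
    |loopMain (1 / (n : NNReal)) b p i X - recSum b p i * ∫ ω, X ω ∂(entryLaw n)| ≤
      (p + 1) * ((1 + B) * (√e * √κ)) := by
  have e1 : loopMain (1 / (n : NNReal)) b p i X - recSum b p i * ∫ ω, X ω ∂(entryLaw n) =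
      ((1 / (n : NNReal) : NNReal) : ℝ) * ∑ j with genRel n b i j, ∑ k ∈ Finset.range (p + 1),
        ((∫ ω, diagEntry n (!b) k j ω * diagEntry n b (p - k) i ω * X ω ∂(entryLaw n)) -
          diagLimit (!b) k (j / n) * diagLimit b (p - k) (i / n) * ∫ ω, X ω ∂(entryLaw n)) := by
    simp only [loopMain, recSum, Finset.sum_sub_distrib, ← Finset.sum_mul]
    push_cast
    rw [one_div]; ring
  have hs : 0 ≤ √e * √κ := by positivity
  rw [e1]
  refine inv_mul_sum_filter_le hn (by positivity) fun j => ?_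
  refine (Finset.abs_sum_le_sum_abs _ _).trans
    ((Finset.sum_le_sum (g := fun _ => (1 + B) * (√e * √κ)) fun k hk => ?_).trans ?_)
  · have hk' : k ≤ p := by rw [Finset.mem_range] at hk; omega
    set a' := diagLimit (!b) k (j / n)
    set a := diagLimit b (p - k) (i / n)
    have q1 : IsGPoly fun ω => diagEntry n (!b) k j ω - a' :=
      (IsGPoly.diagEntry _ _ _).sub (IsGPoly.const _)
    have q2 : IsGPoly fun ω => diagEntry n b (p - k) i ω - a :=
      (IsGPoly.diagEntry _ _ _).sub (IsGPoly.const _)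
    have q3 : IsGPoly fun ω => diagEntry n b (p - k) i ω * X ω := (IsGPoly.diagEntry _ _ _).mul hX
    have e2 : (∫ ω, diagEntry n (!b) k j ω * diagEntry n b (p - k) i ω * X ω ∂(entryLaw n)) -
        a' * a * ∫ ω, X ω ∂(entryLaw n) =
        (∫ ω, (diagEntry n (!b) k j ω - a') * (diagEntry n b (p - k) i ω * X ω) ∂(entryLaw n)) +
          a' * ∫ ω, (diagEntry n b (p - k) i ω - a) * X ω ∂(entryLaw n) := by
      rw [← integral_const_mul, ← integral_const_mul, ← integral_sub, ← integral_add]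
      · congr 1; ext ω; ring
      · exact (q1.mul q3).integrable _
      · exact ((q2.mul hX).integrable _).const_mul _
      · exact (((IsGPoly.diagEntry _ _ _).mul (IsGPoly.diagEntry _ _ _)).mul hX).integrable _
      · exact (hX.integrable _).const_mul _
    rw [e2]
    refine (abs_add_le _ _).trans ?_
    rw [abs_mul, add_mul, one_mul]
    refine add_le_add ?_ (mul_le_mul (hBd k hk' _ j) ?_ (abs_nonneg _) hB)
    · exact abs_integral_mul_le q1 q3 _ (he k hk' _ j) (hκ' _ (Nat.sub_le _ _))
    · exact abs_integral_mul_le q2 hX _ (he _ (Nat.sub_le _ _) _ i) hκ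
  · rw [Finset.sum_const, Finset.card_range, nsmul_eq_mul]
    push_cast; rfl

end

lemma exists_diagLimit_bound (p : ℕ) : ∃ B, 0 ≤ B ∧ ∀ k ≤ p, ∀ (n : ℕ) (b : Bool) (j : Fin n),
    |diagLimit b k (j / n)| ≤ B := by
  obtain ⟨B, hB, h⟩ := exists_abelPoly_bound p
  refine ⟨B, hB, fun k hk n b j => h k hk _ ?_⟩
  have := div_mem_unit (n := n) j.2.le
  split_ifs <;> constructor <;> linarith [this.1, this.2]

/-- The diagonal entries of `(T* T) ^ p` concentrate. -/
lemma exists_tendsto_diagEntry (p : ℕ) : ∃ e : ℕ → ℝ, Tendsto e atTop (𝓝 0) ∧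
    ∀ n : ℕ, 0 < n → ∀ k ≤ p, ∀ (b : Bool) (i : Fin n),
      ∫ ω, (diagEntry n b k i ω - diagLimit b k (i / n)) ^ 2 ∂(entryLaw n) ≤ e n := by
  induction p with
  | zero =>
    refine ⟨fun _ => 0, tendsto_const_nhds, fun n hn k hk b i => ?_⟩
    obtain rfl : k = 0 := by omega
    simp [diagEntry_zero, diagLimit, abelPoly_zero]
  | succ p ih =>
    obtain ⟨e, he, hE⟩ := ih
    obtain ⟨B, hB0, hB⟩ := exists_diagLimit_bound (p + 1)
    obtain ⟨C, hC0, hC⟩ := exists_recursion_bound p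
    -- One bound for all the moments used below; their highest order is 2k + 2(p + 1) ≤ 4p + 2.
    set κ := 8 * momBound (4 * p + 4) with hκ
    have hκ1 := one_le_momBound (4 * p + 4)
    set δ : ℕ → ℝ := fun n => (p + 1) * ((1 + B) * (√(e n) * √κ)) with hδ
    set C₁ := (p + 1) * κ
    have hδ0 : Tendsto δ atTop (𝓝 0) := by
      have h1 : Tendsto (fun n => √(e n)) atTop (𝓝 0) := by
        have := (Real.continuous_sqrt.tendsto 0).comp he
        rwa [Real.sqrt_zero] at this
      simpa using (((h1.mul_const (√κ)).const_mul (1 + B)).const_mul ((p : ℝ) + 1))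
    have hCn : ∀ c : ℝ, Tendsto (fun n : ℕ => c / n) atTop (𝓝 0) := fun c =>
      tendsto_const_div_atTop_nhds_zero_nat c
    refine ⟨fun n => |e n| + |δ n + C₁ / n + (C / n) ^ 2 + (C / n + B) * δ n|, ?_,
      fun n hn k hk b i => ?_⟩
    · have h := ((hδ0.add (hCn C₁)).add ((hCn C).pow 2)).add (((hCn C).add_const B).mul hδ0)
      simpa using he.abs.add h.abs
    · rcases Nat.lt_or_ge k (p + 1) with hk' | hk'
      · exact (hE n hn k (by omega) b i).trans ((le_abs_self _).trans
          (le_add_of_nonneg_right (abs_nonneg _)))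
      obtain rfl : k = p + 1 := by omega
      have hn' : (0 : ℝ) < n := by exact_mod_cast hn
      set α := diagLimit b (p + 1) (i / n)
      set c := recSum b p i
      set Y := diagEntry n b (p + 1) i
      have hY : IsGPoly Y := IsGPoly.diagEntry _ _ _
      have hsq : ∀ k ≤ p + 1, ∫ ω, diagEntry n b k i ω ^ 2 ∂(entryLaw n) ≤ κ := fun k hk => by
        simp only [pow_two]
        have := integral_diagEntry_mul_le hn b i (k := k) (l := k) (m := 4 * p + 4) (by omega)
        rw [hκ]; linarith
      have hE' := fun k hk b i => hE n hn k hk b i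
      have hB' : ∀ k ≤ p, ∀ b (j : Fin n), |diagLimit b k (j / n)| ≤ B := fun k hk b j =>
        hB k (by omega) n b j
      have h1 : |∫ ω, Y ω ∂(entryLaw n) - c| ≤ δ n := by
        have := abs_loopMain_sub_le hn b p i (IsGPoly.const 1) hB0 hB' hE' (κ := κ)
          (by simp only [one_pow, integral_const, probReal_univ, smul_eq_mul]; rw [hκ]; linarith)
          (fun k hk => by simpa using hsq k (by omega))
        rw [← integral_diagEntry_succ] at this
        simpa [-one_div] using this
      have h2 : |loopMain (1 / (n : NNReal)) b p i Y - c * ∫ ω, Y ω ∂(entryLaw n)| ≤ δ n :=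
        abs_loopMain_sub_le hn b p i hY hB0 hB' hE' (hsq (p + 1) le_rfl)
          fun k hk => integral_diagEntry_mul_sq_le hn b i (k := k) (l := p + 1) (m := 4 * p + 4) (by omega)
      have h3 : |∫ ω, Y ω * Y ω ∂(entryLaw n) - loopMain (1 / (n : NNReal)) b p i Y| ≤ C₁ / n := by
        refine (abs_integral_sq_sub_loopMain_le _ b p i).trans ?_
        have e1 : ((1 / (n : NNReal) : NNReal) : ℝ) = (n : ℝ)⁻¹ := by push_cast; rw [one_div]
        rw [e1, div_eq_inv_mul C₁]
        refine mul_le_mul_of_nonneg_left ?_ (by positivity)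
        have : C₁ = ∑ k ∈ Finset.range (p + 1), κ := by simp [C₁]
        rw [this]
        refine Finset.sum_le_sum fun k hk => ?_
        rw [Finset.mem_range] at hk
        simp only [add_mul]
        rw [integral_add (((IsGPoly.diagEntry _ _ _).mul (IsGPoly.diagEntry _ _ _)).integrable _)
          (((IsGPoly.diagEntry _ _ _).mul (IsGPoly.diagEntry _ _ _)).integrable _)]
        have a1 := integral_diagEntry_mul_le hn b i (k := 2 * p + 1) (l := p - k) (m := 4 * p + 4)
          (by omega)
        have a2 := integral_diagEntry_mul_le hn b i (k := 2 * k + 1) (l := p - k) (m := 4 * p + 4)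
          (by omega)
        rw [hκ]; linarith
      have h4 : |c - α| ≤ C / n := hC n hn b i
      have h5 : |α| ≤ B := hB (p + 1) le_rfl n b i
      have h6 : ∫ ω, (Y ω - α) ^ 2 ∂(entryLaw n) =
          ∫ ω, Y ω * Y ω ∂(entryLaw n) - 2 * α * ∫ ω, Y ω ∂(entryLaw n) + α ^ 2 := by
        have : ∀ ω, (Y ω - α) ^ 2 = (Y ω * Y ω - 2 * α * Y ω) + α ^ 2 := fun ω => by ring
        simp only [this]
        have i1 := (hY.mul hY).integrable (1 / (n : NNReal))
        have i2 := (hY.integrable (1 / (n : NNReal))).const_mul (2 * α)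
        rw [integral_add (f := fun ω => Y ω * Y ω - 2 * α * Y ω) (i1.sub i2) (integrable_const _),
          integral_sub i1 i2, integral_const_mul]
        simp [-one_div]
      rw [h6]
      refine le_trans ?_ ((le_abs_self _).trans (le_add_of_nonneg_left (abs_nonneg _)))
      set EY := ∫ ω, Y ω ∂(entryLaw n)
      set EYY := ∫ ω, Y ω * Y ω ∂(entryLaw n)
      set m := loopMain (1 / (n : NNReal)) b p i Y
      have g1 := (le_abs_self _).trans h3
      have g2 := (le_abs_self _).trans h2
      have g3 : (c - α) ^ 2 ≤ (C / n) ^ 2 := by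
        rw [← sq_abs]; gcongr
      have g4 : (c - 2 * α) * (EY - c) ≤ (C / n + B) * δ n := by
        refine (le_abs_self _).trans ?_
        rw [abs_mul]
        refine mul_le_mul ?_ h1 (abs_nonneg _) (by positivity)
        have : c - 2 * α = (c - α) - α := by ring
        rw [this]
        exact (abs_sub _ _).trans (add_le_add h4 h5)
      -- Four errors: the derivative term of the loop equation, its main term against c · E[Y], the
      -- Riemann sum c against α, and the mean against c.
      have : EYY - 2 * α * EY + α ^ 2 = (EYY - m) + (m - c * EY) + (c - α) ^ 2 +
          (c - 2 * α) * (EY - c) := by ring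
      rw [this]
      linarith

/-- The limit of the mean of the normalized trace of `(T* T) ^ p`. -/
lemma tendsto_mean_diagEntry (p : ℕ) :
    Tendsto (fun n : ℕ => (n : ℝ)⁻¹ * ∑ i : Fin n, ∫ ω, diagEntry n false p i ω ∂(entryLaw n))
      atTop (𝓝 ((p : ℝ) ^ p / (p + 1).factorial)) := by
  obtain ⟨e, he, hE⟩ := exists_tendsto_diagEntry p
  obtain ⟨L, hL0, hL⟩ := exists_riemann_bound p
  rw [tendsto_iff_norm_sub_tendsto_zero]
  have h0 : Tendsto (fun n : ℕ => √(e n) + L / n) atTop (𝓝 0) := by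
    have h1 : Tendsto (fun n => √(e n)) atTop (𝓝 0) := by
      have := (Real.continuous_sqrt.tendsto 0).comp he
      rwa [Real.sqrt_zero] at this
    simpa using h1.add (tendsto_const_div_atTop_nhds_zero_nat L)
  refine squeeze_zero' (Eventually.of_forall fun n => norm_nonneg _) ?_ h0
  filter_upwards [eventually_gt_atTop 0] with n hn
  have hn' : (0 : ℝ) < n := by exact_mod_cast hn
  have hR := (hL n hn 0 n (Nat.zero_le _) le_rfl).1
  rw [div_self hn'.ne', sub_self, Nat.cast_zero, zero_div, zero_sub,
    abelPoly_succ_apply_zero, zero_sub, abelPoly_succ_neg_one, ← Finset.range_eq_Ico,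
    ← Fin.sum_univ_eq_sum_range (fun j => abelPoly p ((j : ℝ) / n)) n] at hR
  have hD : |(n : ℝ)⁻¹ * ∑ i : Fin n, ∫ ω, diagEntry n false p i ω ∂(entryLaw n) -
      (n : ℝ)⁻¹ * ∑ i : Fin n, abelPoly p ((i : ℕ) / n)| ≤ √(e n) := by
    rw [← mul_sub, ← Finset.sum_sub_distrib, abs_mul, abs_of_pos (inv_pos.2 hn'),
      inv_mul_le_iff₀ hn']
    refine (Finset.abs_sum_le_sum_abs _ _).trans
      ((Finset.sum_le_sum (g := fun _ => √(e n)) fun i _ => ?_).trans ?_)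
    · have q : IsGPoly fun ω => diagEntry n false p i ω - diagLimit false p (i / n) :=
        (IsGPoly.diagEntry _ _ _).sub (IsGPoly.const _)
      have := abs_integral_mul_le q (IsGPoly.const 1) (1 / (n : NNReal))
        (hE n hn p le_rfl false i) (c := 1) (by simp)
      simp only [mul_one, Real.sqrt_one] at this
      rw [integral_sub ((IsGPoly.diagEntry _ _ _).integrable _) (integrable_const _)] at this
      simpa [diagLimit, -one_div] using this
    · simp
  rw [Real.norm_eq_abs]
  refine (abs_sub_le _ ((n : ℝ)⁻¹ * ∑ i : Fin n, abelPoly p ((i : ℕ) / n)) _).trans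
    (add_le_add hD hR)

/-! ### The `*`-moments of the model -/

lemma evMat_true_eq_upperRM (n : ℕ) (ω : DTSample n) : evMat n ω.2 true = upperRM n ω :=
  evMat_true n ω.2

/-- The alternating word `(z* z) ^ p`. -/
def altWord (p : ℕ) : List Bool := (List.replicate p [true, false]).flatten

lemma starWord_altWord {A : Type*} [Monoid A] [Star A] (z : A) (p : ℕ) :
    starWord z (altWord p) = (star z * z) ^ p := by
  induction p with
  | zero => simp [starWord, altWord]
  | succ p ih =>
    rw [pow_succ', ← ih]
    simp [starWord, altWord, List.replicate_succ, mul_assoc]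

lemma dtMoment_altWord (n : ℕ) (p : ℕ) :
    dtMoment (Measure.dirac 0) 1 n (altWord p) =
      (((n : ℝ)⁻¹ * ∑ i : Fin n, ∫ ω, diagEntry n false p i ω ∂(entryLaw n) : ℝ) : ℂ) := by
  -- For μ = δ_0 the diagonal part is almost surely zero, so the model is T_n alone.
  have h1 : (Measure.pi fun _ : Fin n => Measure.dirac (0 : ℂ)) = Measure.dirac 0 :=
    Measure.pi_eq fun s hs => by
      classical
      rw [Measure.dirac_apply' _ (MeasurableSet.univ_pi hs)]
      simp only [Measure.dirac_apply' _ (hs _), Set.indicator_apply, Pi.one_apply]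
      rw [Finset.prod_ite_zero]
      simp [Set.mem_pi]
  have h2 : ∀ ω : Fin n × Fin n → ℂ, (n : ℂ)⁻¹ *
      (starWord (dtRM 1 n (0, ω)) (altWord p)).trace =
      (((n : ℝ)⁻¹ * ∑ i, diagEntry n false p i ω : ℝ) : ℂ) := by
    intro ω
    have e : dtRM 1 n (0, ω) = evMat n ω true := by
      rw [dtRM, ← evMat_true_eq_upperRM]
      simp [diagRM]
    rw [starWord_altWord, e, Matrix.trace]
    push_cast
    congr 1
    refine Finset.sum_congr rfl fun i _ => ?_
    rw [ofReal_diagEntry, Bool.not_false, show evMat n ω false = star (evMat n ω true) from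
      evMat_not n ω true]
    rfl
  rw [dtMoment, dtMeasure, h1, Measure.dirac_prod, integral_map (by fun_prop)]
  · simp only [h2]
    refine (integral_ofReal (𝕜 := ℂ)
      (f := fun ω => (n : ℝ)⁻¹ * ∑ i, diagEntry n false p i ω)).trans ?_
    rw [integral_const_mul, integral_finsetSum]
    · rfl
    · exact fun i _ => (IsGPoly.diagEntry _ _ _).integrable _
  · have hc : Continuous (dtRM 1 n) := by
      refine continuous_matrix fun i j => ?_
      simp only [dtRM, diagRM, upperRM, Matrix.add_apply, Matrix.smul_apply, Matrix.of_apply,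
        Matrix.diagonal_apply]
      split_ifs <;> fun_prop
    simp only [starWord_altWord]
    exact (continuous_const.mul ((hc.star.mul hc).pow p).matrix_trace).aestronglyMeasurable

/-- The moments of `T* T` for a `DT(δ₀, 1)`-element. -/
lemma IsDTElement.moment {A : Type*} [Ring A] [StarRing A] [Algebra ℂ A] [StarModule ℂ A]
    {τ : A →ₗ[ℂ] ℂ} {T : A} (h : IsDTElement τ (Measure.dirac (0 : ℂ)) 1 T) (p : ℕ) :
    τ ((star T * T) ^ p) = (((p : ℝ) ^ p / (p + 1).factorial : ℝ) : ℂ) := by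
  have h1 := h.tendsto (altWord p)
  rw [starWord_altWord] at h1
  simp only [dtMoment_altWord] at h1
  exact tendsto_nhds_unique h1 ((Complex.continuous_ofReal.tendsto _).comp
    (tendsto_mean_diagEntry p))

end FreeProb
end

noncomputable section
namespace FreeProb
open Real

/-! ### The parametrization of the density -/

lemma hasDerivAt_cot {v : ℝ} (hv : sin v ≠ 0) : HasDerivAt cot (-(1 / sin v ^ 2)) v := by
  have h := (hasDerivAt_cos v).fun_div (hasDerivAt_sin v) hv
  have e : cot = fun v => cos v / sin v := funext cot_eq_cos_div_sin
  rw [e]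
  refine h.congr_deriv ?_
  rw [neg_div', div_left_inj' (pow_ne_zero 2 hv)]
  linarith [sin_sq_add_cos_sq v]

lemma sin_pos_of_mem {v : ℝ} (hv : v ∈ Set.Ioo 0 π) : 0 < sin v := sin_pos_of_mem_Ioo hv

lemma rho_pos {v : ℝ} (hv : v ∈ Set.Ioo 0 π) : 0 < rho v :=
  mul_pos (div_pos (sin_pos_of_mem hv) hv.1) (exp_pos _)

/-- Minus the derivative of `rho`. -/
def rhoDer (v : ℝ) : ℝ := rho v * ((1 - v * cot v) ^ 2 + v ^ 2) / v

lemma rhoDer_pos {v : ℝ} (hv : v ∈ Set.Ioo 0 π) : 0 < rhoDer v := by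
  have := rho_pos hv
  have hv0 := hv.1
  unfold rhoDer; positivity

lemma hasDerivAt_mul_cot {v : ℝ} (hv : sin v ≠ 0) :
    HasDerivAt (fun v => v * cot v) (cot v - v / sin v ^ 2) v := by
  refine ((hasDerivAt_id' v).fun_mul (hasDerivAt_cot hv)).congr_deriv ?_
  ring

lemma hasDerivAt_rho {v : ℝ} (hv : v ∈ Set.Ioo 0 π) : HasDerivAt rho (-rhoDer v) v := by
  have hs := (sin_pos_of_mem hv).ne'
  have hv0 := hv.1.ne'
  have h := ((hasDerivAt_sin v).fun_div (hasDerivAt_id' v) hv0).fun_mul (hasDerivAt_mul_cot hs).exp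
  refine h.congr_deriv ?_
  simp only [rhoDer, rho]
  rw [cot_eq_cos_div_sin]
  field_simp
  linear_combination (v ^ 2) * sin_sq_add_cos_sq v

lemma rho_strictAntiOn : StrictAntiOn rho (Set.Ioo 0 π) := by
  refine strictAntiOn_of_deriv_neg (convex_Ioo 0 π)
    (fun v hv => (hasDerivAt_rho hv).continuousAt.continuousWithinAt) fun v hv => ?_
  rw [interior_Ioo] at hv
  rw [(hasDerivAt_rho hv).deriv]
  linarith [rhoDer_pos hv]

/-- In this form the singularity at 0 is removable and the limit e can be read off. -/
lemma rho_eq_sinc {v : ℝ} (hv : v ≠ 0) : rho v = sinc v * exp (cos v / sinc v) := by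
  rw [rho, sinc_of_ne_zero hv, cot_eq_cos_div_sin]
  congr 2
  rw [div_div_eq_mul_div, mul_comm, div_mul_eq_mul_div]

lemma tendsto_rho_zero : Tendsto rho (𝓝[>] 0) (𝓝 (exp 1)) := by
  have h : Tendsto (fun v => sinc v * exp (cos v / sinc v)) (𝓝 0)
      (𝓝 (sinc 0 * exp (cos 0 / sinc 0))) := by
    have h1 := continuous_sinc.continuousAt (x := 0)
    have h2 := continuous_cos.continuousAt (x := 0)
    exact (h1.mul (h2.div h1 (by simp)).rexp)
  simp only [sinc_zero, cos_zero, div_one, one_mul] at h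
  refine (h.mono_left nhdsWithin_le_nhds).congr' ?_
  filter_upwards [self_mem_nhdsWithin] with v hv
  exact (rho_eq_sinc (ne_of_gt hv)).symm

lemma rho_le_sin_div {v : ℝ} (hv : v ∈ Set.Ico (π / 2) π) : rho v ≤ sin v / v := by
  have hπ := pi_pos
  have hv0 : 0 < v := by linarith [hv.1]
  have hs := sin_pos_of_mem ⟨hv0, hv.2⟩
  have hc : cos v ≤ 0 := cos_nonpos_of_pi_div_two_le_of_le hv.1 (by linarith [hv.2])
  rw [rho]
  refine mul_le_of_le_one_right (by positivity) (exp_le_one_iff.2 ?_)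
  rw [cot_eq_cos_div_sin]
  exact mul_nonpos_of_nonneg_of_nonpos hv0.le (div_nonpos_of_nonpos_of_nonneg hc hs.le)

lemma tendsto_rho_pi : Tendsto rho (𝓝[<] π) (𝓝 0) := by
  have h : Tendsto (fun v => sin v / v) (𝓝[<] π) (𝓝 0) := by
    have : ContinuousAt (fun v => sin v / v) π :=
      continuous_sin.continuousAt.div continuousAt_id pi_ne_zero
    have := this.tendsto
    rw [sin_pi, zero_div] at this
    exact this.mono_left nhdsWithin_le_nhds
  have hm : Set.Ico (π / 2) π ∈ 𝓝[<] π := Ico_mem_nhdsLT (by linarith [pi_pos])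
  refine squeeze_zero' ?_ ?_ h
  · filter_upwards [hm] with v hv
    exact (rho_pos ⟨by linarith [hv.1, pi_pos], hv.2⟩).le
  · filter_upwards [hm] with v hv using rho_le_sin_div hv

lemma continuousOn_rho : ContinuousOn rho (Set.Ioo 0 π) := fun _ hv =>
  (hasDerivAt_rho hv).continuousAt.continuousWithinAt

lemma rho_lt_exp_one {v : ℝ} (hv : v ∈ Set.Ioo 0 π) : rho v < exp 1 := by
  have hw : v / 2 ∈ Set.Ioo 0 π := ⟨by linarith [hv.1], by linarith [hv.1, hv.2]⟩
  refine (rho_strictAntiOn hw hv (by linarith [hv.1])).trans_le ?_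
  refine ge_of_tendsto tendsto_rho_zero ?_
  filter_upwards [Ioo_mem_nhdsGT hw.1] with u hu
  exact (rho_strictAntiOn ⟨hu.1, hu.2.trans hw.2⟩ hw hu.2).le

lemma bijOn_rho : Set.BijOn rho (Set.Ioo 0 π) (Set.Ioo 0 (exp 1)) := by
  refine ⟨fun _ hv => ⟨rho_pos hv, rho_lt_exp_one hv⟩, rho_strictAntiOn.injOn, ?_⟩
  have h1 : 𝓝[>] (0 : ℝ) ≤ 𝓟 (Set.Ioo 0 π) := le_principal_iff.2 (Ioo_mem_nhdsGT pi_pos)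
  have h2 : 𝓝[<] π ≤ 𝓟 (Set.Ioo 0 π) := le_principal_iff.2 (Ioo_mem_nhdsLT pi_pos)
  exact isPreconnected_Ioo.intermediate_value_Ioo h2 h1 continuousOn_rho tendsto_rho_pi
    tendsto_rho_zero

/-- The density in terms of the parameter. -/
def psi (v : ℝ) : ℝ := 1 / π * sin v * exp (-(v * cot v))

lemma psi_pos {v : ℝ} (hv : v ∈ Set.Ioo 0 π) : 0 < psi v := by
  have := sin_pos_of_mem hv
  have := pi_pos
  unfold psi; positivity

/-- The exponentials cancel. The product is continuous on the whole line and zero at 0 and π, which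
makes the boundary terms in the moment computation vanish. -/
lemma rho_mul_psi (v : ℝ) : rho v * psi v = sin v * sinc v / π := by
  rcases eq_or_ne v 0 with rfl | hv
  · simp [rho, psi]
  rw [sinc_of_ne_zero hv, rho, psi, exp_neg]
  have := exp_ne_zero (v * cot v)
  field_simp

/-- The simple form of this derivative is what reduces the moments of the law to the integrals of
ρ^p. -/
lemma hasDerivAt_psi {v : ℝ} (hv : v ∈ Set.Ioo 0 π) : HasDerivAt psi (1 / (π * rho v)) v := by
  have hs := (sin_pos_of_mem hv).ne'
  have hv0 := hv.1.ne'
  have h := ((hasDerivAt_sin v).const_mul (1 / π)).fun_mul (hasDerivAt_mul_cot hs).fun_neg.exp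
  refine h.congr_deriv ?_
  have he := exp_ne_zero (v * cot v)
  have e : 1 / (π * rho v) = 1 / π * (v / sin v) * exp (-(v * cot v)) := by
    rw [rho, exp_neg]; field_simp
  rw [e, cot_eq_cos_div_sin]
  field_simp
  ring

lemma strictMonoOn_psi : StrictMonoOn psi (Set.Ioo 0 π) := by
  refine strictMonoOn_of_deriv_pos (convex_Ioo 0 π)
    (fun v hv => (hasDerivAt_psi hv).continuousAt.continuousWithinAt) fun v hv => ?_
  rw [interior_Ioo] at hv
  rw [(hasDerivAt_psi hv).deriv]
  have := rho_pos hv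
  have := pi_pos
  positivity

/-- The transported density extends continuously to [0, π], hence it is integrable although ψ is
unbounded near π. -/
lemma rhoDer_mul_psi {v : ℝ} (hv : v ∈ Set.Ioo 0 π) :
    rhoDer v * psi v = 1 / π * ((sinc v - cos v) ^ 2 + sin v ^ 2) := by
  have hs := (sin_pos_of_mem hv).ne'
  have hv0 := hv.1.ne'
  have : rhoDer v * psi v = (rho v * psi v) * ((1 - v * cot v) ^ 2 + v ^ 2) / v := by
    rw [rhoDer]; ring
  rw [this, rho_mul_psi, sinc_of_ne_zero hv0, cot_eq_cos_div_sin]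
  field_simp

end FreeProb
end

noncomputable section
namespace FreeProb
open Complex

/-! ### The integral of the powers of `rho` -/

/-- The entire function `exp (p (exp ζ - ζ))`. -/
def entireKer (p : ℕ) (ζ : ℂ) : ℂ := cexp (p * (cexp ζ - ζ))

/-- A primitive on the whole plane replaces contour deformation: every path integral becomes a
difference of values of G. -/
lemma exists_primitive_entireKer (p : ℕ) : ∃ G : ℂ → ℂ, ∀ z, HasDerivAt G (entireKer p z) z := by
  have h : Differentiable ℂ (entireKer p) := by unfold entireKer; fun_prop
  obtain ⟨G, hG⟩ := h.isExactOn_univ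
  exact ⟨G, fun z => hG z (Set.mem_univ z)⟩

lemma hasDerivAt_im_comp {G : ℂ → ℂ} {γ : ℝ → ℂ} {g γ' : ℂ} {t : ℝ} (hG : HasDerivAt G g (γ t))
    (hγ : HasDerivAt γ γ' t) : HasDerivAt (fun t => (G (γ t)).im) (g * γ').im t :=
  imCLM.hasFDerivAt.comp_hasDerivAt t (hG.comp t hγ)

lemma entireKer_re_im (p : ℕ) (a b : ℝ) : entireKer p (a + b * I) =
    cexp ((p * (Real.exp a * Real.cos b - a) : ℝ) + (p * (Real.exp a * Real.sin b - b) : ℝ) * I) := by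
  rw [entireKer, Complex.exp_add, exp_mul_I]
  congr 1
  push_cast
  ring

lemma norm_entireKer (p : ℕ) (a b : ℝ) :
    ‖entireKer p (a + b * I)‖ = Real.exp (p * (Real.exp a * Real.cos b - a)) := by
  rw [entireKer_re_im, norm_exp]
  simp only [add_re, ofReal_re, re_ofReal_mul, I_re, mul_zero, add_zero]

lemma re_entireKer (p : ℕ) (a b : ℝ) : (entireKer p (a + b * I)).re =
    Real.exp (p * (Real.exp a * Real.cos b - a)) * Real.cos (p * (Real.exp a * Real.sin b - b)) := by
  rw [entireKer_re_im, exp_re]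
  simp only [add_re, add_im, ofReal_re, ofReal_im, re_ofReal_mul, im_ofReal_mul, I_re, I_im,
    mul_zero, mul_one, add_zero, zero_add]

lemma im_entireKer (p : ℕ) (a b : ℝ) : (entireKer p (a + b * I)).im =
    Real.exp (p * (Real.exp a * Real.cos b - a)) * Real.sin (p * (Real.exp a * Real.sin b - b)) := by
  rw [entireKer_re_im, exp_im]
  simp only [add_re, add_im, ofReal_re, ofReal_im, re_ofReal_mul, im_ofReal_mul, I_re, I_im,
    mul_zero, mul_one, add_zero, zero_add]

lemma hasDerivAt_vertical (a b : ℝ) : HasDerivAt (fun t : ℝ => (a : ℂ) + t * I) I b := by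
  have := ((ofRealCLM.hasDerivAt (x := b)).mul_const I).const_add (a : ℂ)
  simpa using this

lemma hasDerivAt_horizontal (a b : ℝ) : HasDerivAt (fun t : ℝ => (t : ℂ) + b * I) 1 a :=
  (ofRealCLM.hasDerivAt (x := a)).add_const _

section
variable {p : ℕ} {G : ℂ → ℂ} (hG : ∀ z, HasDerivAt G (entireKer p z) z)
include hG

lemma hasDerivAt_im_vertical (a b : ℝ) : HasDerivAt (fun t : ℝ => (G (a + t * I)).im)
    (entireKer p (a + b * I)).re b := by
  refine (hasDerivAt_im_comp (hG _) (hasDerivAt_vertical a b)).congr_deriv ?_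
  simp

/-- For Im ζ = π the imaginary part of p(e^ζ - ζ) is -pπ, so the kernel is real there and Im G does
not change along this line. -/
lemma im_horizontal (a : ℝ) : (G (a + Real.pi * I)).im = (G (Real.pi * I)).im := by
  have hd : ∀ a : ℝ, HasDerivAt (fun t : ℝ => (G (t + Real.pi * I)).im) 0 a := fun a => by
    refine (hasDerivAt_im_comp (hG _) (hasDerivAt_horizontal a Real.pi)).congr_deriv ?_
    rw [mul_one, im_entireKer, Real.sin_pi, mul_zero, zero_sub, mul_neg, Real.sin_neg,
      Real.sin_nat_mul_pi, neg_zero, mul_zero]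
  have := is_const_of_deriv_eq_zero (fun a => (hd a).differentiableAt) (fun a => (hd a).deriv) a 0
  simpa using this

/-- For a ≥ 0 and cos t ≤ 0 the kernel has modulus at most 1. The vertical segment up to the line Im
ζ = π therefore contributes at most its length, however large a is; this controls the end of the
contour that escapes to infinity. -/
lemma abs_im_vertical_sub_le {a v : ℝ} (ha : 0 ≤ a) (hv : v ∈ Set.Ico (Real.pi / 2) Real.pi) :
    |(G (Real.pi * I)).im - (G (a + v * I)).im| ≤ Real.pi - v := by
  rw [← im_horizontal hG a]
  have h := Convex.norm_image_sub_le_of_norm_hasDerivWithin_le (C := 1)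
    (f := fun t : ℝ => (G (a + t * I)).im) (f' := fun t : ℝ => (entireKer p (a + t * I)).re)
    (s := Set.Icc v Real.pi) (x := v) (y := Real.pi)
    (fun t _ => (hasDerivAt_im_vertical hG a t).hasDerivWithinAt)
    (fun t ht => by
      refine (abs_re_le_norm _).trans ?_
      rw [norm_entireKer, Real.exp_le_one_iff]
      have hc : Real.cos t ≤ 0 := Real.cos_nonpos_of_pi_div_two_le_of_le (hv.1.trans ht.1)
        (by linarith [ht.2, Real.pi_pos])
      refine mul_nonpos_of_nonneg_of_nonpos p.cast_nonneg ?_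
      have := mul_nonpos_of_nonneg_of_nonpos (Real.exp_pos a).le hc
      linarith)
    (convex_Icc _ _) ⟨le_rfl, hv.2.le⟩ ⟨hv.2.le, le_rfl⟩
  rw [one_mul, Real.norm_eq_abs, Real.norm_eq_abs, abs_of_nonneg (sub_nonneg.2 hv.2.le)] at h
  exact h

/-- With z = e^(it) the integral over a period is that of e^(pz)/z^(p+1) on the unit circle, and
Cauchy's formula gives the p-th Taylor coefficient of e^(pz). -/
lemma primitive_period : G (2 * Real.pi * I) - G 0 = 2 * Real.pi * I * (p ^ p / p.factorial) := by
  have hd : ∀ t : ℝ, HasDerivAt (fun t : ℝ => G (t * I)) (entireKer p (t * I) * I) t := fun t => by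
    have := hasDerivAt_vertical 0 t
    simp only [ofReal_zero, zero_add] at this
    exact (hG _).comp t this
  have hcont : Continuous fun t : ℝ => entireKer p (t * I) * I := by unfold entireKer; fun_prop
  have h1 := intervalIntegral.integral_eq_sub_of_hasDerivAt (a := 0) (b := 2 * Real.pi)
    (fun t _ => hd t) (hcont.intervalIntegrable _ _)
  have hc := DiffContOnCl.circleIntegral_one_div_sub_center_pow_smul (c := 0) (R := 1) one_pos p
    (f := fun z : ℂ => cexp (p * z)) (by
      have : Differentiable ℂ fun z : ℂ => cexp (p * z) := by fun_prop
      exact this.diffContOnCl)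
  rw [iteratedDeriv_cexp_const_mul] at hc
  have h2 : (∮ z in C(0, 1), (1 / (z - 0) ^ (p + 1)) • cexp (p * z)) =
      ∫ t in (0 : ℝ)..2 * Real.pi, entireKer p (t * I) * I := by
    rw [circleIntegral]
    refine intervalIntegral.integral_congr fun t _ => ?_
    simp only [deriv_circleMap, circleMap, ofReal_one, one_mul, zero_add, sub_zero, smul_eq_mul,
      entireKer]
    rw [mul_sub, Complex.exp_sub, Complex.exp_nat_mul (t * I) p, pow_succ]
    have e1 := Complex.exp_ne_zero (t * I)
    field_simp
  rw [h2, h1] at hc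
  push_cast at hc
  simp only [zero_mul] at hc
  rw [hc]
  simp
  ring

/-- The real part of the kernel on the imaginary axis is symmetric about iπ, so Im G(i(π+t)) + Im
G(i(π-t)) is constant; comparing t = π with t = 0 halves the full period. -/
lemma im_half_period : (G (Real.pi * I)).im - (G 0).im = Real.pi * (p ^ p / p.factorial) := by
  have hd : ∀ t : ℝ, HasDerivAt (fun t : ℝ => (G (((0 : ℝ) : ℂ) + ((Real.pi + t : ℝ) : ℂ) * I)).im +
      (G (((0 : ℝ) : ℂ) + ((Real.pi - t : ℝ) : ℂ) * I)).im) 0 t := fun t => by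
    have h1 := (hasDerivAt_im_vertical hG 0 (Real.pi + t)).comp_const_add Real.pi t
    have h2 := (hasDerivAt_im_vertical hG 0 (Real.pi - t)).comp_const_sub Real.pi t
    refine (h1.fun_add h2).congr_deriv ?_
    rw [re_entireKer, re_entireKer, Real.exp_zero, one_mul, one_mul, one_mul, one_mul,
      Real.cos_pi_sub, add_comm Real.pi t, Real.cos_add_pi, Real.sin_add_pi, Real.sin_pi_sub]
    have : Real.cos (p * (-Real.sin t - (t + Real.pi))) =
        Real.cos (p * (Real.sin t - (Real.pi - t))) := by
      rw [← Real.cos_neg, ← Real.cos_sub_nat_mul_two_pi _ p]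
      congr 1; ring
    rw [this, add_neg_cancel]
  have h := is_const_of_deriv_eq_zero (fun a => (hd a).differentiableAt) (fun a => (hd a).deriv)
    Real.pi 0
  have hp := congrArg Complex.im (primitive_period hG)
  have e : (2 * Real.pi * I * ((p : ℂ) ^ p / p.factorial)).im =
      2 * Real.pi * ((p : ℝ) ^ p / p.factorial) := by
    have : (2 * Real.pi * I * ((p : ℂ) ^ p / p.factorial)) =
      ((2 * Real.pi * ((p : ℝ) ^ p / p.factorial) : ℝ) : ℂ) * I := by push_cast; ring
    rw [this, im_ofReal_mul, I_im, mul_one]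
  rw [e, sub_im] at hp
  have e2 : ((0 : ℝ) : ℂ) + ((Real.pi + Real.pi : ℝ) : ℂ) * I = 2 * Real.pi * I := by
    push_cast; ring
  have e3 : ((0 : ℝ) : ℂ) + ((Real.pi - Real.pi : ℝ) : ℂ) * I = 0 := by simp
  have e4 : ((0 : ℝ) : ℂ) + ((Real.pi + 0 : ℝ) : ℂ) * I = Real.pi * I := by simp
  have e5 : ((0 : ℝ) : ℂ) + ((Real.pi - 0 : ℝ) : ℂ) * I = Real.pi * I := by simp
  rw [e2, e3, e4, e5] at h
  linarith

end

lemma integrableOn_rho_pow (p : ℕ) : IntegrableOn (fun v => rho v ^ p) (Set.Ioo 0 Real.pi) := by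
  refine Integrable.of_bound ?_ (Real.exp 1 ^ p) ?_
  · exact (continuousOn_rho.fun_pow p).aestronglyMeasurable measurableSet_Ioo
  · filter_upwards [ae_restrict_mem measurableSet_Ioo] with v hv
    rw [norm_pow, Real.norm_of_nonneg (rho_pos hv).le]
    exact pow_le_pow_left₀ (rho_pos hv).le (rho_lt_exp_one hv).le p

lemma intervalIntegrable_rho_pow (p : ℕ) :
    IntervalIntegrable (fun v => rho v ^ p) volume 0 Real.pi := by
  rw [intervalIntegrable_iff_integrableOn_Ioo_of_le Real.pi_pos.le]
  exact integrableOn_rho_pow p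

lemma sinc_pos {v : ℝ} (hv : v ∈ Set.Ioo 0 Real.pi) : 0 < Real.sinc v := by
  rw [Real.sinc_of_ne_zero hv.1.ne']
  exact div_pos (sin_pos_of_mem hv) hv.1

/-- The real part a = -log(sinc v) solves e^a sin v = v, which makes e^ζ - ζ real on the curve. -/
lemma entireKer_contour (p : ℕ) {v : ℝ} (hv : v ∈ Set.Ioo 0 Real.pi) :
    entireKer p ((-Real.log (Real.sinc v) : ℝ) + v * I) = ((rho v ^ p : ℝ) : ℂ) := by
  have hs := (sin_pos_of_mem hv).ne'
  have hv0 := hv.1.ne'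
  have h0 := sinc_pos hv
  rw [entireKer_re_im, Real.exp_neg, Real.exp_log h0, rho_eq_sinc hv0, mul_pow]
  have e1 : (Real.sinc v)⁻¹ * Real.sin v - v = 0 := by
    rw [Real.sinc_of_ne_zero hv0]; field_simp; simp
  rw [e1, mul_zero, ofReal_zero, zero_mul, add_zero, ← ofReal_exp]
  congr 1
  rw [mul_sub, Real.exp_sub, mul_neg, Real.exp_neg, div_inv_eq_mul, Real.exp_nat_mul,
    Real.exp_nat_mul, Real.exp_log h0, mul_comm, inv_mul_eq_div]

/-- The Nuttall–Bouwkamp integral. -/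
lemma integral_rho_pow (p : ℕ) :
    ∫ v in (0 : ℝ)..Real.pi, rho v ^ p = Real.pi * (p ^ p / p.factorial) := by
  obtain ⟨G, hG⟩ := exists_primitive_entireKer p
  rw [← im_half_period hG]
  have hGc : Continuous G := continuous_iff_continuousAt.2 fun z => (hG z).continuousAt
  -- The curve starts at 0, and its real part tends to +∞ as v → π. The kernel is real on it and Im
  -- γ' = 1, so Im G along γ is a primitive of ρ^p.
  set γ : ℝ → ℂ := fun v => (-Real.log (Real.sinc v) : ℝ) + v * I with hγ
  refine intervalIntegral.integral_eq_sub_of_hasDerivAt_of_tendsto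
    (f := fun v => (G (γ v)).im) Real.pi_pos (fun v hv => ?_) (intervalIntegrable_rho_pow p) ?_ ?_
  · have hv0 := hv.1.ne'
    obtain ⟨l, hl⟩ : ∃ l : ℝ, HasDerivAt (fun v => -Real.log (Real.sinc v)) l v := by
      have h1 : HasDerivAt (fun v => -Real.log (Real.sin v / v)) _ v :=
        (((Real.hasDerivAt_sin v).fun_div (hasDerivAt_id' v) hv0).log
          (div_pos (sin_pos_of_mem hv) hv.1).ne').fun_neg
      refine ⟨_, h1.congr_of_eventuallyEq ?_⟩
      filter_upwards [eventually_ne_nhds hv0] with u hu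
      rw [Real.sinc_of_ne_zero hu]
    have h2 : HasDerivAt γ ((l : ℂ) + I) v := by
      have h3 := hasDerivAt_vertical 0 v
      simp only [ofReal_zero, zero_add] at h3
      exact hl.ofReal_comp.fun_add h3
    refine (hasDerivAt_im_comp (hG _) h2).congr_deriv ?_
    rw [hγ, entireKer_contour p hv, im_ofReal_mul]
    simp
  · have h : ContinuousAt (fun v => (G (γ v)).im) 0 := by
      have h1 : ContinuousAt γ 0 := by
        have := (Real.continuous_sinc.continuousAt (x := 0)).log (by simp)
        exact (continuous_ofReal.continuousAt.comp this.neg).add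
          (continuous_ofReal.mul continuous_const).continuousAt
      exact continuous_im.continuousAt.comp (hGc.continuousAt.comp h1)
    have := h.tendsto
    simp only [hγ, Real.sinc_zero, Real.log_one, neg_zero, ofReal_zero, zero_mul, add_zero] at this
    exact this.mono_left nhdsWithin_le_nhds
  · rw [tendsto_iff_norm_sub_tendsto_zero]
    have h0 : Tendsto (fun v => Real.pi - v) (𝓝[<] Real.pi) (𝓝 0) := by
      have : Tendsto (fun v => Real.pi - v) (𝓝 Real.pi) (𝓝 (Real.pi - Real.pi)) :=
        (continuous_const.sub continuous_id).tendsto _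
      rw [sub_self] at this
      exact this.mono_left nhdsWithin_le_nhds
    refine squeeze_zero' (Eventually.of_forall fun _ => norm_nonneg _) ?_ h0
    have hm : Set.Ico (Real.pi / 2) Real.pi ∈ 𝓝[<] Real.pi :=
      Ico_mem_nhdsLT (by linarith [Real.pi_pos])
    filter_upwards [hm] with v hv
    rw [norm_sub_rev, Real.norm_eq_abs]
    refine abs_im_vertical_sub_le hG ?_ hv
    have hv' : v ∈ Set.Ioo 0 Real.pi := ⟨by linarith [hv.1, Real.pi_pos], hv.2⟩
    exact neg_nonneg.2 (Real.log_nonpos (sinc_pos hv').le (Real.sinc_le_one v))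

end FreeProb
end

noncomputable section
namespace FreeProb
open Real

/-! ### The limiting distribution -/

open Classical in
/-- The density of the limiting distribution. -/
def dtDensity (x : ℝ) : ℝ :=
  if x ∈ Set.Ioo 0 (exp 1) then psi (Function.invFunOn rho (Set.Ioo 0 π) x) else 0

lemma dtDensity_rho {v : ℝ} (hv : v ∈ Set.Ioo 0 π) : dtDensity (rho v) = psi v := by
  rw [dtDensity, if_pos (bijOn_rho.mapsTo hv), bijOn_rho.injOn.leftInvOn_invFunOn hv]

lemma dtDensity_of_notMem {x : ℝ} (hx : x ∉ Set.Ioo 0 (exp 1)) : dtDensity x = 0 := if_neg hx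

lemma dtDensity_pos {x : ℝ} (hx : x ∈ Set.Ioo 0 (exp 1)) : 0 < dtDensity x := by
  obtain ⟨v, hv, rfl⟩ := bijOn_rho.surjOn hx
  rw [dtDensity_rho hv]
  exact psi_pos hv

lemma dtDensity_nonneg (x : ℝ) : 0 ≤ dtDensity x := by
  by_cases hx : x ∈ Set.Ioo 0 (exp 1)
  · exact (dtDensity_pos hx).le
  · exact (dtDensity_of_notMem hx).ge

/-- Monotonicity makes the superlevel sets order-connected, and so yields measurability without a
study of the inverse of ρ. -/
lemma antitoneOn_dtDensity : AntitoneOn dtDensity (Set.Ioo 0 (exp 1)) := by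
  intro x hx y hy hxy
  obtain ⟨v, hv, rfl⟩ := bijOn_rho.surjOn hx
  obtain ⟨w, hw, rfl⟩ := bijOn_rho.surjOn hy
  rw [dtDensity_rho hv, dtDensity_rho hw]
  exact strictMonoOn_psi.monotoneOn hw hv ((rho_strictAntiOn.le_iff_ge hv hw).1 hxy)

lemma measurable_dtDensity : Measurable dtDensity := by
  refine measurable_of_Ioi fun c => ?_
  rcases lt_or_ge c 0 with hc | hc
  · have : dtDensity ⁻¹' Set.Ioi c = Set.univ :=
      Set.eq_univ_of_forall fun x => hc.trans_le (dtDensity_nonneg x)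
    rw [this]
    exact MeasurableSet.univ
  · have h : ∀ x, c < dtDensity x → x ∈ Set.Ioo 0 (exp 1) := fun x hx => by
      by_contra h
      rw [dtDensity_of_notMem h] at hx
      exact absurd hx (not_lt.2 hc)
    refine Set.OrdConnected.measurableSet ⟨fun x hx y hy z hz => ?_⟩
    have h1 := h x hx
    have h2 := h y hy
    exact lt_of_lt_of_le hy (antitoneOn_dtDensity ⟨h1.1.trans_le hz.1, hz.2.trans_lt h2.2⟩ h2 hz.2)

/-- The limiting distribution. -/
def dtLaw : Measure ℝ := volume.withDensity fun x => ENNReal.ofReal (dtDensity x)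

lemma setIntegral_dtDensity_mul (f : ℝ → ℝ) :
    ∫ x, dtDensity x * f x = ∫ v in Set.Ioo 0 π, rhoDer v * psi v * f (rho v) := by
  have h1 : ∫ x, dtDensity x * f x = ∫ x in Set.Ioo 0 (exp 1), dtDensity x * f x := by
    refine (setIntegral_eq_integral_of_forall_compl_eq_zero fun x hx => ?_).symm
    rw [dtDensity_of_notMem hx, zero_mul]
  rw [h1, ← bijOn_rho.image_eq, integral_image_eq_integral_abs_deriv_smul measurableSet_Ioo
    (fun v hv => (hasDerivAt_rho hv).hasDerivWithinAt) bijOn_rho.injOn]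
  refine setIntegral_congr_fun measurableSet_Ioo fun v hv => ?_
  change |-rhoDer v| • (dtDensity (rho v) * f (rho v)) = _
  rw [abs_neg, abs_of_pos (rhoDer_pos hv), dtDensity_rho hv, smul_eq_mul, mul_assoc]

lemma integrableOn_rhoDer_mul_psi : IntegrableOn (fun v => rhoDer v * psi v) (Set.Ioo 0 π) := by
  have h : Continuous fun v => 1 / π * ((sinc v - cos v) ^ 2 + sin v ^ 2) := by
    have := continuous_sinc
    fun_prop
  have h2 : IntegrableOn (fun v => 1 / π * ((sinc v - cos v) ^ 2 + sin v ^ 2)) (Set.Ioo 0 π) :=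
    (h.integrableOn_Icc).mono_set Set.Ioo_subset_Icc_self
  exact h2.congr_fun (fun v hv => (rhoDer_mul_psi hv).symm) measurableSet_Ioo

lemma integrable_dtDensity : Integrable dtDensity := by
  have h : IntegrableOn dtDensity (Set.Ioo 0 (exp 1)) := by
    rw [← bijOn_rho.image_eq, integrableOn_image_iff_integrableOn_abs_deriv_smul measurableSet_Ioo
      (fun v hv => (hasDerivAt_rho hv).hasDerivWithinAt) bijOn_rho.injOn]
    refine integrableOn_rhoDer_mul_psi.congr_fun (fun v hv => ?_) measurableSet_Ioo
    simp only
    rw [abs_neg, abs_of_pos (rhoDer_pos hv), dtDensity_rho hv, smul_eq_mul]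
  exact (integrableOn_iff_integrable_of_support_subset fun x hx => by
    by_contra h
    exact hx (dtDensity_of_notMem h)).1 h

lemma integral_dtLaw (f : ℝ → ℝ) :
    ∫ x, f x ∂dtLaw = ∫ v in Set.Ioo 0 π, rhoDer v * psi v * f (rho v) := by
  rw [dtLaw, integral_withDensity_eq_integral_toReal_smul (by
    exact measurable_dtDensity.ennreal_ofReal) (ae_of_all _ fun x => ENNReal.ofReal_lt_top),
    ← setIntegral_dtDensity_mul]
  refine integral_congr_ae (ae_of_all _ fun x => ?_)
  simp only
  rw [ENNReal.toReal_ofReal (dtDensity_nonneg x), smul_eq_mul]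

/-- The moments of the limiting distribution. -/
lemma integral_pow_dtLaw (p : ℕ) : ∫ x, x ^ p ∂dtLaw = (p : ℝ) ^ p / (p + 1).factorial := by
  rw [integral_dtLaw]
  -- The derivative of ρ^(p+1) ψ is ρ^p/π minus (p + 1) times the integrand, and Φ tends to 0 at
  -- both ends.
  set Φ : ℝ → ℝ := fun v => rho v ^ (p + 1) * psi v
  have hΦ : ∀ v ∈ Set.Ioo 0 π, HasDerivAt Φ
      (rho v ^ p * (1 / π) - (p + 1) * (rhoDer v * psi v * rho v ^ p)) v := fun v hv => by
    refine (((hasDerivAt_rho hv).fun_pow (p + 1)).fun_mul (hasDerivAt_psi hv)).congr_deriv ?_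
    have := (rho_pos hv).ne'
    have := pi_ne_zero
    rw [add_tsub_cancel_right]
    push_cast
    field_simp
    ring
  have hΦ2 : ∀ v, Φ v = rho v ^ p * (sin v * sinc v / π) := fun v => by
    simp only [Φ]
    rw [pow_succ, mul_assoc, rho_mul_psi]
  have hi1 : IntervalIntegrable (fun v => rho v ^ p * (1 / π)) volume 0 π :=
    (intervalIntegrable_rho_pow p).mul_const _
  have hi2 : IntegrableOn (fun v => rhoDer v * psi v * rho v ^ p) (Set.Ioo 0 π) := by
    refine Integrable.mul_bdd (c := exp 1 ^ p) integrableOn_rhoDer_mul_psi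
      ((continuousOn_rho.fun_pow p).aestronglyMeasurable measurableSet_Ioo) ?_
    filter_upwards [ae_restrict_mem measurableSet_Ioo] with v hv
    rw [norm_pow, Real.norm_of_nonneg (rho_pos hv).le]
    exact pow_le_pow_left₀ (rho_pos hv).le (rho_lt_exp_one hv).le p
  have hi2' : IntervalIntegrable (fun v => (p + 1) * (rhoDer v * psi v * rho v ^ p)) volume 0 π := by
    refine IntervalIntegrable.const_mul ?_ _
    rw [intervalIntegrable_iff_integrableOn_Ioo_of_le pi_pos.le]
    exact hi2
  have hcs : Tendsto (fun v => sin v * sinc v / π) (𝓝 0) (𝓝 0) := by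
    have : ContinuousAt (fun v => sin v * sinc v / π) 0 :=
      ((continuous_sin.mul continuous_sinc).div_const π).continuousAt
    have h := this.tendsto
    simpa using h
  have hcs' : Tendsto (fun v => sin v * sinc v / π) (𝓝 π) (𝓝 0) := by
    have : ContinuousAt (fun v => sin v * sinc v / π) π :=
      ((continuous_sin.mul continuous_sinc).div_const π).continuousAt
    have h := this.tendsto
    rwa [sin_pi, zero_mul, zero_div] at h
  have key := intervalIntegral.integral_eq_sub_of_hasDerivAt_of_tendsto pi_pos hΦ (hi1.sub hi2')
    (fa := 0) (fb := 0) (by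
      have := (tendsto_rho_zero.pow p).mul (hcs.mono_left nhdsWithin_le_nhds)
      rw [mul_zero] at this
      exact this.congr fun v => (hΦ2 v).symm)
    (by
      have := (tendsto_rho_pi.pow p).mul (hcs'.mono_left nhdsWithin_le_nhds)
      rw [mul_zero] at this
      exact this.congr fun v => (hΦ2 v).symm)
  rw [intervalIntegral.integral_sub hi1 hi2', intervalIntegral.integral_mul_const,
    intervalIntegral.integral_const_mul, integral_rho_pow,
    intervalIntegral.integral_of_le pi_pos.le, integral_Ioc_eq_integral_Ioo] at key
  have hf : ((p + 1).factorial : ℝ) = (p + 1) * p.factorial := by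
    rw [Nat.factorial_succ]; push_cast; rfl
  have hp : (p.factorial : ℝ) ≠ 0 := by positivity
  have hp1 : (p : ℝ) + 1 ≠ 0 := by positivity
  have := pi_ne_zero
  rw [hf]
  field_simp at key ⊢
  linarith

instance : IsProbabilityMeasure dtLaw := by
  constructor
  -- The total mass is the moment of order 0, with 0^0 = 1.
  have h := integral_pow_dtLaw 0
  have h2 := setIntegral_dtDensity_mul fun _ => 1
  rw [integral_dtLaw] at h
  simp only [pow_zero] at h
  rw [h] at h2
  simp only [mul_one, zero_add, Nat.factorial_one, Nat.cast_one,
    div_one] at h2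
  rw [dtLaw, withDensity_apply _ MeasurableSet.univ, Measure.restrict_univ,
    ← ofReal_integral_eq_lintegral_ofReal integrable_dtDensity (ae_of_all _ dtDensity_nonneg), h2,
    ENNReal.ofReal_one]

lemma support_dtLaw : dtLaw.support = Set.Icc 0 (exp 1) := by
  refine Set.Subset.antisymm (Measure.support_subset_of_isClosed isClosed_Icc ?_) ?_
  · rw [mem_ae_iff, dtLaw, withDensity_apply _ measurableSet_Icc.compl]
    refine (setLIntegral_congr_fun measurableSet_Icc.compl fun x hx => ?_).trans lintegral_zero
    rw [dtDensity_of_notMem fun h => hx (Set.Ioo_subset_Icc_self h), ENNReal.ofReal_zero]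
  · rw [← closure_Ioo (exp_pos 1).ne]
    refine closure_minimal (fun x hx => ?_) Measure.isClosed_support
    rw [Measure.mem_support_iff_forall]
    intro U hU
    rw [pos_iff_ne_zero, dtLaw, ne_eq,
      withDensity_apply_eq_zero measurable_dtDensity.ennreal_ofReal]
    refine (Measure.measure_pos_of_mem_nhds volume (x := x)
      (inter_mem (mem_of_superset (Ioo_mem_nhds hx.1 hx.2) fun y hy => ?_) hU)).ne'
    exact (ENNReal.ofReal_pos.2 (dtDensity_pos hy)).ne'

/-! ### Determination by moments -/

lemma exists_support_subset_Icc {ν : Measure ℝ} (h : IsCompact ν.support) :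
    ∃ R, 0 ≤ R ∧ ∀ᵐ x ∂ν, x ∈ Set.Icc (-R) R := by
  obtain ⟨R, hR⟩ := h.isBounded.subset_closedBall 0
  rw [Real.closedBall_eq_Icc, zero_sub, zero_add] at hR
  refine ⟨|R|, abs_nonneg R, ?_⟩
  filter_upwards [Measure.support_mem_ae] with x hx
  have := hR hx
  exact ⟨(neg_le_neg (le_abs_self R)).trans this.1, this.2.trans (le_abs_self R)⟩

lemma integrable_of_ae_mem_Icc {ν : Measure ℝ} [IsFiniteMeasure ν] {R : ℝ}
    (h : ∀ᵐ x ∂ν, x ∈ Set.Icc (-R) R) {f : ℝ → ℝ} (hf : Continuous f) : Integrable f ν := by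
  obtain ⟨C, hC⟩ := (isCompact_Icc (a := -R) (b := R)).exists_bound_of_continuousOn hf.continuousOn
  refine Integrable.of_bound hf.aestronglyMeasurable C ?_
  filter_upwards [h] with x hx using hC x hx

/-- Both measures live on a common compact interval, where polynomials are uniformly dense in the
continuous functions. -/
lemma measure_eq_of_moments {μ ν : Measure ℝ} [IsProbabilityMeasure μ] [IsProbabilityMeasure ν]
    (hμ : IsCompact μ.support) (hν : IsCompact ν.support)
    (h : ∀ p : ℕ, ∫ x, x ^ p ∂μ = ∫ x, x ^ p ∂ν) : μ = ν := by
  obtain ⟨R₁, h1, hR₁⟩ := exists_support_subset_Icc hμ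
  obtain ⟨R₂, h2, hR₂⟩ := exists_support_subset_Icc hν
  set R := max R₁ R₂
  have hμR : ∀ᵐ x ∂μ, x ∈ Set.Icc (-R) R := hR₁.mono fun x hx =>
    Set.Icc_subset_Icc (neg_le_neg (le_max_left _ _)) (le_max_left _ _) hx
  have hνR : ∀ᵐ x ∂ν, x ∈ Set.Icc (-R) R := hR₂.mono fun x hx =>
    Set.Icc_subset_Icc (neg_le_neg (le_max_right _ _)) (le_max_right _ _) hx
  have hpoly : ∀ q : Polynomial ℝ, ∫ x, q.eval x ∂μ = ∫ x, q.eval x ∂ν := fun q => by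
    simp only [Polynomial.eval_eq_sum_range]
    rw [integral_finsetSum, integral_finsetSum]
    · simp only [integral_const_mul, h]
    · exact fun i _ => (integrable_of_ae_mem_Icc hνR (continuous_pow i)).const_mul _
    · exact fun i _ => (integrable_of_ae_mem_Icc hμR (continuous_pow i)).const_mul _
  refine ext_of_forall_integral_eq_of_IsFiniteMeasure fun f => ?_
  have hbound : ∀ ε > 0, |∫ x, f x ∂μ - ∫ x, f x ∂ν| ≤ 2 * ε := fun ε hε => by
    obtain ⟨q, hq⟩ := exists_polynomial_near_of_continuousOn (-R) R f f.continuous.continuousOn ε hε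
    have key : ∀ κ : Measure ℝ, IsProbabilityMeasure κ → (∀ᵐ x ∂κ, x ∈ Set.Icc (-R) R) →
        |∫ x, f x ∂κ - ∫ x, q.eval x ∂κ| ≤ ε := fun κ hκ hκR => by
      rw [← integral_sub (integrable_of_ae_mem_Icc hκR f.continuous)
        (integrable_of_ae_mem_Icc hκR q.continuous)]
      have := norm_integral_le_of_norm_le_const (μ := κ) (C := ε)
        (f := fun x => f x - q.eval x) (hκR.mono fun x hx => by
          rw [Real.norm_eq_abs, abs_sub_comm]; exact (hq x hx).le)
      simpa using this
    have k1 := abs_le.1 (key μ inferInstance hμR)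
    have k2 := abs_le.1 (key ν inferInstance hνR)
    rw [hpoly] at k1
    rw [abs_le]
    constructor <;> linarith [k1.1, k1.2, k2.1, k2.2]
  have h0 : |∫ x, f x ∂μ - ∫ x, f x ∂ν| ≤ 0 := le_of_forall_pos_le_add fun ε hε => by
    have := hbound (ε / 2) (by positivity)
    linarith
  exact sub_eq_zero.1 (abs_nonpos_iff.1 h0)

end FreeProb
end

noncomputable section
namespace FreeProb

/-! ### Continuous functional calculus in a von Neumann algebra -/

section VonNeumannCalculus

variable {H : Type*} [NormedAddCommGroup H] [InnerProductSpace ℂ H] [CompleteSpace H]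
  {M : VonNeumannAlgebra H} {τ : M.toStarSubalgebra →ₗ[ℂ] ℂ}

/-- The functional calculus of a commutes with everything that commutes with a, in particular with
the commutant of M; the double commutant is M. -/
lemma exists_coe_eq_cfc (a : M.toStarSubalgebra) (f : ℝ → ℝ) :
    ∃ b : M.toStarSubalgebra, (b : H →L[ℂ] H) = cfc f (a : H →L[ℂ] H) := by
  have h : cfc f (a : H →L[ℂ] H) ∈ M.commutant.commutant := by
    rw [VonNeumannAlgebra.mem_commutant_iff]
    intro g hg
    rw [VonNeumannAlgebra.mem_commutant_iff] at hg
    have hc : Commute (a : H →L[ℂ] H) g := hg a a.2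
    exact (hc.cfc_real f).eq.symm
  rw [VonNeumannAlgebra.commutant_commutant] at h
  exact ⟨⟨_, h⟩, rfl⟩

lemma exists_coe_eq_aeval (a : M.toStarSubalgebra) {ν : Measure ℝ}
    (hν : IsDistribution τ a ν) (q : Polynomial ℝ) :
    ∃ b : M.toStarSubalgebra, (b : H →L[ℂ] H) = Polynomial.aeval (a : H →L[ℂ] H) q ∧
      τ b = ((∫ x, q.eval x ∂ν : ℝ) : ℂ) := by
  have := hν.isProbabilityMeasure
  obtain ⟨R, -, hR⟩ := exists_support_subset_Icc hν.isCompact_support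
  refine ⟨∑ i ∈ Finset.range (q.natDegree + 1), ((q.coeff i : ℝ) : ℂ) • a ^ i, ?_, ?_⟩
  · rw [Polynomial.aeval_eq_sum_range, AddSubmonoidClass.coe_finsetSum]
    refine Finset.sum_congr rfl fun i _ => ?_
    rw [← Complex.coe_smul (q.coeff i)]
    rfl
  · simp only [Polynomial.eval_eq_sum_range]
    rw [integral_finsetSum, map_sum, Complex.ofReal_sum]
    · refine Finset.sum_congr rfl fun i _ => ?_
      rw [map_smul, hν.moment, integral_const_mul, Complex.ofReal_mul, smul_eq_mul]
    · exact fun i _ => (integrable_of_ae_mem_Icc hR (continuous_pow i)).const_mul _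

/-- Let q be a polynomial within δ/2 of f on an interval containing both spectrum and support. Then
δ/2 - f + q is nonnegative on the spectrum, so its value at a is c*c and positivity gives τ(b) ≤ δ/2
+ ∫ q dν ≤ δ + ∫ f dν. -/
lemma re_apply_cfc_le {a b : M.toStarSubalgebra} {ν : Measure ℝ} (hτ : IsState τ)
    (ha : IsSelfAdjoint (a : H →L[ℂ] H)) (hν : IsDistribution τ a ν) {f : ℝ → ℝ}
    (hf : Continuous f) (hb : (b : H →L[ℂ] H) = cfc f (a : H →L[ℂ] H)) :
    (τ b).re ≤ ∫ x, f x ∂ν := by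
  have := hν.isProbabilityMeasure
  obtain ⟨R₀, -, hR₀⟩ := exists_support_subset_Icc hν.isCompact_support
  set a' : H →L[ℂ] H := (a : H →L[ℂ] H)
  -- The factor ‖1‖ covers the zero Hilbert space, where the identity has norm 0.
  set R := max R₀ (‖a'‖ * ‖(1 : H →L[ℂ] H)‖)
  have hR : ∀ᵐ x ∂ν, x ∈ Set.Icc (-R) R := hR₀.mono fun x hx =>
    Set.Icc_subset_Icc (neg_le_neg (le_max_left _ _)) (le_max_left _ _) hx
  have hspec : ∀ x ∈ spectrum ℝ a', x ∈ Set.Icc (-R) R := fun x hx => by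
    have := abs_le.1 ((spectrum.norm_le_norm_mul_of_mem hx).trans (le_max_right R₀ _))
    exact this
  refine le_of_forall_pos_le_add fun δ hδ => ?_
  obtain ⟨q, hq⟩ := exists_polynomial_near_of_continuousOn (-R) R f hf.continuousOn (δ / 2)
    (by positivity)
  obtain ⟨d, hd, hτd⟩ := exists_coe_eq_aeval a hν q
  have hqc : Continuous fun x => q.eval x := q.continuous
  set g : ℝ → ℝ := fun x => √(δ / 2 - f x + q.eval x)
  have hg : Continuous g := by fun_prop
  obtain ⟨c, hc⟩ := exists_coe_eq_cfc a g
  have hcc : star c * c = ((δ / 2 : ℝ) : ℂ) • (1 : M.toStarSubalgebra) - b + d := by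
    apply Subtype.ext
    change star (c : H →L[ℂ] H) * (c : H →L[ℂ] H)
      = ((δ / 2 : ℝ) : ℂ) • (1 : H →L[ℂ] H) - (b : H →L[ℂ] H) + (d : H →L[ℂ] H)
    have hsa : star (cfc g a') = cfc g a' := (cfc_predicate g a' : IsSelfAdjoint _)
    rw [hc, hsa, ← cfc_mul g g a' hg.continuousOn hg.continuousOn, hb, hd, ← cfc_polynomial q a' ha,
      Complex.coe_smul, ← Algebra.algebraMap_eq_smul_one, ← cfc_const (δ / 2) a' ha,
      ← cfc_sub _ _ a' continuousOn_const hf.continuousOn,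
      ← cfc_add a' _ _ (by fun_prop) hqc.continuousOn]
    refine cfc_congr fun x hx => ?_
    have := abs_lt.1 (hq x (hspec x hx))
    exact Real.mul_self_sqrt (by linarith [this.1])
  have h1 := hτ.re_nonneg c
  rw [hcc, map_add, map_sub, map_smul, hτ.map_one, hτd] at h1
  simp only [smul_eq_mul, mul_one, Complex.add_re, Complex.sub_re, Complex.ofReal_re] at h1
  have h2 : ∫ x, q.eval x ∂ν ≤ ∫ x, (f x + δ / 2) ∂ν :=
    integral_mono_ae (integrable_of_ae_mem_Icc hR hqc)
      (integrable_of_ae_mem_Icc hR (by fun_prop)) (hR.mono fun x hx => by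
        have := abs_lt.1 (hq x hx)
        change q.eval x ≤ f x + δ / 2
        linarith [this.2])
  rw [integral_add (integrable_of_ae_mem_Icc hR hf) (integrable_const _), integral_const,
    probReal_univ, one_smul] at h2
  linarith

lemma re_apply_cfc {a b : M.toStarSubalgebra} {ν : Measure ℝ} (hτ : IsState τ)
    (ha : IsSelfAdjoint (a : H →L[ℂ] H)) (hν : IsDistribution τ a ν) {f : ℝ → ℝ}
    (hf : Continuous f) (hb : (b : H →L[ℂ] H) = cfc f (a : H →L[ℂ] H)) :
    (τ b).re = ∫ x, f x ∂ν := by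
  refine le_antisymm (re_apply_cfc_le hτ ha hν hf hb) ?_
  have h := re_apply_cfc_le (f := fun x => -f x) (b := -b) hτ ha hν hf.neg (by
    rw [cfc_neg, ← hb]; rfl)
  rw [map_neg, Complex.neg_re, integral_neg] at h
  linarith

/-- Here τ(f(a)* f(a)) = ∫ f² dν = 0, and faithfulness gives f(a) = 0. -/
lemma cfc_eq_zero_of_ae {a : M.toStarSubalgebra} {ν : Measure ℝ}
    (hτ : IsFaithfulNormalState M τ) (ha : IsSelfAdjoint (a : H →L[ℂ] H))
    (hν : IsDistribution τ a ν) {f : ℝ → ℝ} (hf : Continuous f) (h0 : ∀ᵐ x ∂ν, f x = 0) :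
    cfc f (a : H →L[ℂ] H) = 0 := by
  obtain ⟨b, hb⟩ := exists_coe_eq_cfc a f
  have hsa : star (cfc f (a : H →L[ℂ] H)) = cfc f (a : H →L[ℂ] H) :=
    (cfc_predicate f (a : H →L[ℂ] H) : IsSelfAdjoint _)
  have hbb : ((star b * b : M.toStarSubalgebra) : H →L[ℂ] H)
      = cfc (fun x => f x * f x) (a : H →L[ℂ] H) := by
    rw [cfc_mul f f _ hf.continuousOn hf.continuousOn, ← hb]
    rw [← hb] at hsa
    exact congrArg (· * (b : H →L[ℂ] H)) hsa
  have h1 := re_apply_cfc hτ.isState ha hν (hf.mul hf) hbb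
  rw [integral_eq_zero_of_ae (h0.mono fun x hx => by simp [hx])] at h1
  have hb0 := hτ.faithful b (Complex.ext h1 (hτ.isState.im_eq_zero b))
  rw [← hb, hb0]
  rfl

/-- The spectrum of a self-adjoint element of a von Neumann algebra with a faithful normal state
is the support of its distribution. -/
theorem spectrum_eq_support {a : M.toStarSubalgebra} {ν : Measure ℝ}
    (hτ : IsFaithfulNormalState M τ) (ha : IsSelfAdjoint (a : H →L[ℂ] H))
    (hν : IsDistribution τ a ν) : spectrum ℝ (a : H →L[ℂ] H) = ν.support := by
  have := hν.isProbabilityMeasure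
  have hcpt := hν.isCompact_support
  apply Set.Subset.antisymm
  · intro x hx
    -- `Metric.infDist` to the empty set is 0 by convention, so it detects membership in a closed
    -- set only when that set is nonempty; the same is checked for the spectrum below.
    have hne : ν.support.Nonempty := by
      by_contra h
      have := Measure.support_mem_ae (μ := ν)
      rw [Set.not_nonempty_iff_eq_empty.1 h, mem_ae_iff, Set.compl_empty, measure_univ] at this
      exact one_ne_zero this
    have hf : Continuous fun y => Metric.infDist y ν.support := Metric.continuous_infDist_pt _
    have h := cfc_eq_zero_of_ae hτ ha hν hf
      (mem_of_superset Measure.support_mem_ae fun y hy => Metric.infDist_zero_of_mem hy)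
    rw [← cfc_zero ℝ (a : H →L[ℂ] H),
      cfc_eq_cfc_iff_eqOn (g := 0) ha hf.continuousOn continuousOn_const] at h
    exact (Measure.isClosed_support.mem_iff_infDist_zero hne).2 (h hx)
  · have hcl : IsClosed (spectrum ℝ (a : H →L[ℂ] H)) := spectrum.isClosed _
    intro x hx
    by_contra hxs
    have : Nontrivial (H →L[ℂ] H) := ⟨1, 0, fun h => by
      have h10 : (1 : M.toStarSubalgebra) = 0 := Subtype.ext h
      have h1 := hτ.isState.map_one
      rw [h10, map_zero] at h1
      exact zero_ne_one h1⟩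
    have hne := ContinuousFunctionalCalculus.spectrum_nonempty (R := ℝ) (a : H →L[ℂ] H) ha
    have hf : Continuous fun y => Metric.infDist y (spectrum ℝ (a : H →L[ℂ] H)) :=
      Metric.continuous_infDist_pt _
    obtain ⟨b, hb⟩ := exists_coe_eq_cfc a fun y => Metric.infDist y (spectrum ℝ (a : H →L[ℂ] H))
    have h1 := re_apply_cfc hτ.isState ha hν hf hb
    have hb0 : b = 0 := by
      apply Subtype.ext
      rw [hb]
      refine (cfc_congr (g := 0) fun y hy => Metric.infDist_zero_of_mem hy).trans (cfc_zero ℝ _)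
    rw [hb0, map_zero, Complex.zero_re, eq_comm] at h1
    obtain ⟨R, -, hR⟩ := exists_support_subset_Icc hcpt
    rw [integral_eq_zero_iff_of_nonneg (fun y => Metric.infDist_nonneg)
      (integrable_of_ae_mem_Icc hR hf)] at h1
    rw [Measure.mem_support_iff_forall] at hx
    refine (hx _ (hcl.isOpen_compl.mem_nhds hxs)).ne' (measure_mono_null ?_ h1)
    exact fun y hy h => hy ((hcl.mem_iff_infDist_zero hne).2 h)

/-- If the distribution of a self-adjoint element of a von Neumann algebra with a faithful normal
state has no atom at `0`, then the element is injective. -/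
theorem ker_eq_bot_of_measure_singleton {a : M.toStarSubalgebra} {ν : Measure ℝ}
    (hτ : IsFaithfulNormalState M τ) (ha : IsSelfAdjoint (a : H →L[ℂ] H))
    (hν : IsDistribution τ a ν) (h0 : ν {0} = 0) : (a : H →L[ℂ] H).ker = ⊥ := by
  have := hν.isProbabilityMeasure
  set a' : H →L[ℂ] H := (a : H →L[ℂ] H) with ha'
  have : CompleteSpace a'.ker := a'.isClosed_ker.completeSpace_coe
  set P' : H →L[ℂ] H := a'.ker.starProjection with hP'
  have hP : IsStarProjection P' := isStarProjection_starProjection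
  -- The kernel of a is invariant under every operator commuting with a, so its projection lies in
  -- M.
  have hPM : P' ∈ M := by
    rw [VonNeumannAlgebra.IsStarProjection.mem_iff hP]
    intro y hy
    rw [VonNeumannAlgebra.mem_commutant_iff] at hy
    rw [hP', Submodule.range_starProjection, Module.End.mem_invtSubmodule]
    intro x hx
    have h1 : a' (y x) = y (a' x) := congrArg (fun z : H →L[ℂ] H => z x) (hy a' a.2)
    have h2 : a' x = 0 := hx
    change a' (y x) = 0
    rw [h1, h2, map_zero]
  have haP : a' * P' = 0 := by
    ext x
    exact (Submodule.starProjection_apply_mem a'.ker x : _)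
  set P : M.toStarSubalgebra := ⟨P', hPM⟩
  have hPP : star P * P = P := Subtype.ext (by
    change star P' * P' = P'
    rw [hP.isSelfAdjoint.star_eq, hP.isIdempotentElem.eq])
  -- With g(x) = 1/(1 + m x²), g(a) fixes the kernel, whence P ≤ g(a)². As m grows, the functions g²
  -- decrease to the indicator of {0}.
  have key : ∀ m : ℕ, (τ P).re ≤ ∫ x, (1 + (m : ℝ) * x ^ 2)⁻¹ * (1 + (m : ℝ) * x ^ 2)⁻¹ ∂ν := by
    intro m
    have hpos : ∀ x : ℝ, 1 + (m : ℝ) * x ^ 2 ≠ 0 := fun x => by positivity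
    set g : ℝ → ℝ := fun x => (1 + (m : ℝ) * x ^ 2)⁻¹
    have hg : Continuous g := by fun_prop (disch := exact hpos _)
    obtain ⟨c, hc⟩ := exists_coe_eq_cfc a g
    obtain ⟨b, hb⟩ := exists_coe_eq_cfc a fun x => g x * g x
    have hcP : cfc g a' * P' = P' := by
      have h1 : cfc g a' * cfc (fun x => 1 + (m : ℝ) * x ^ 2) a' = 1 := by
        rw [← cfc_mul _ _ a' hg.continuousOn (by fun_prop), ← cfc_one ℝ a' ha]
        exact cfc_congr fun x _ => inv_mul_cancel₀ (hpos x)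
      have h2 : cfc (fun x => 1 + (m : ℝ) * x ^ 2) a' * P' = P' := by
        rw [cfc_const_add _ _ a' (by fun_prop) ha, cfc_const_mul _ _ a' (by fun_prop),
          cfc_pow_id a' 2 ha, add_mul, smul_mul_assoc, pow_two, mul_assoc, haP]
        simp
      calc cfc g a' * P' = cfc g a' * (cfc (fun x => 1 + (m : ℝ) * x ^ 2) a' * P') := by rw [h2]
        _ = P' := by rw [← mul_assoc, h1, one_mul]
    have hsa : star (cfc g a') = cfc g a' := (cfc_predicate g a' : IsSelfAdjoint _)
    have hPc : P' * cfc g a' = P' := by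
      have := congrArg star hcP
      rwa [star_mul, hsa, hP.isSelfAdjoint.star_eq] at this
    -- Writing g(a)² - P as a square lets positivity of τ apply directly.
    have hbP : star (c * (1 - P)) * (c * (1 - P)) = b - P := by
      apply Subtype.ext
      change star ((c : H →L[ℂ] H) * (1 - P')) * ((c : H →L[ℂ] H) * (1 - P'))
        = (b : H →L[ℂ] H) - P'
      rw [hc, hb, cfc_mul g g _ hg.continuousOn hg.continuousOn, star_mul, hsa, star_sub, star_one,
        hP.isSelfAdjoint.star_eq, mul_sub, mul_one, sub_mul, one_mul, hcP, hPc, mul_sub, sub_mul,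
        sub_mul, hPc, hP.isIdempotentElem.eq, hcP]
      abel
    have h1 := hτ.isState.re_nonneg (c * (1 - P))
    rw [hbP, map_sub, Complex.sub_re, re_apply_cfc hτ.isState ha hν (hg.mul hg) hb] at h1
    exact sub_nonneg.1 h1
  have hlim : Tendsto (fun m : ℕ => ∫ x, (1 + (m : ℝ) * x ^ 2)⁻¹ * (1 + (m : ℝ) * x ^ 2)⁻¹ ∂ν)
      atTop (𝓝 (∫ _, (0 : ℝ) ∂ν)) := by
    refine tendsto_integral_of_dominated_convergence (fun _ => 1)
      (fun m => (by fun_prop : Measurable _).aestronglyMeasurable) (integrable_const _)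
      (fun m => ae_of_all _ fun x => ?_) ?_
    · have h1 : (1 + (m : ℝ) * x ^ 2)⁻¹ ≤ 1 := inv_le_one_of_one_le₀ (by
        have : 0 ≤ (m : ℝ) * x ^ 2 := by positivity
        linarith)
      rw [Real.norm_of_nonneg (by positivity)]
      exact mul_le_one₀ h1 (by positivity) h1
    · have h0' : ∀ᵐ x ∂ν, x ≠ 0 := by
        rw [ae_iff]
        simpa using h0
      filter_upwards [h0'] with x hx
      have h1 : Tendsto (fun m : ℕ => 1 + (m : ℝ) * x ^ 2) atTop atTop :=
        tendsto_atTop_add_const_left _ _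
          (tendsto_natCast_atTop_atTop.atTop_mul_const (by positivity))
      simpa using h1.inv_tendsto_atTop.mul h1.inv_tendsto_atTop
  rw [integral_zero] at hlim
  have hle : (τ P).re ≤ 0 := ge_of_tendsto' hlim key
  have hnn := hτ.isState.re_nonneg P
  have him := hτ.isState.im_eq_zero P
  have hP0 : P = 0 := hτ.faithful P (Complex.ext
    (le_antisymm (by rw [hPP]; exact hle) hnn) him)
  have hP0' : P' = 0 := congrArg Subtype.val hP0
  rw [← Submodule.range_starProjection a'.ker, ← hP', hP0']
  exact LinearMap.range_zero

end VonNeumannCalculus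

/-! ### From the distribution of T*T to the theorem -/

lemma norm_eq_of_spectrum_eq_Icc {A : Type*} [CStarAlgebra A] {a : A} {r : ℝ}
    (ha : IsSelfAdjoint a) (hr : 0 ≤ r) (h : spectrum ℝ a = Set.Icc 0 r) : ‖a‖ = r := by
  have : Nontrivial A := by
    by_contra hn
    rw [not_nontrivial_iff_subsingleton] at hn
    rw [spectrum.of_subsingleton] at h
    exact Set.notMem_empty r (h ▸ Set.right_mem_Icc.2 hr)
  apply le_antisymm
  · rcases CStarAlgebra.norm_or_neg_norm_mem_spectrum ha with h1 | h1 <;> rw [h] at h1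
    · exact h1.2
    · linarith [h1.1]
  · have h1 : r ∈ spectrum ℝ a := h ▸ Set.right_mem_Icc.2 hr
    simpa [abs_of_nonneg hr] using spectrum.norm_le_norm_of_mem h1

lemma isDistribution_dtLaw {A : Type*} [Ring A] [StarRing A] [Algebra ℂ A] [StarModule ℂ A]
    {τ : A →ₗ[ℂ] ℂ} {T : A} (hT : IsDTElement τ (Measure.dirac (0 : ℂ)) 1 T) :
    IsDistribution τ (star T * T) dtLaw where
  isProbabilityMeasure := inferInstance
  isCompact_support := by rw [support_dtLaw]; exact isCompact_Icc
  moment p := by rw [hT.moment p, integral_pow_dtLaw]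

end FreeProb
end

theorem mainTheorem9 :
    (∀ {A : Type*} [Ring A] [StarRing A] [Algebra ℂ A] [StarModule ℂ A]
      (τ : A →ₗ[ℂ] ℂ) (T : A), FreeProb.IsState τ →
      FreeProb.IsDTElement τ (Measure.dirac (0 : ℂ)) 1 T →
      ∃ ν : Measure ℝ,
        FreeProb.IsDistribution τ (star T * T) ν ∧
        (∀ ν' : Measure ℝ, FreeProb.IsDistribution τ (star T * T) ν' → ν' = ν) ∧
        ν ≪ volume ∧
        ν.support = Set.Icc 0 (Real.exp 1) ∧
        Set.BijOn FreeProb.rho (Set.Ioo 0 Real.pi) (Set.Ioo 0 (Real.exp 1)) ∧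
        ∃ φ : ℝ → ℝ, Measurable φ ∧
          (∀ v ∈ Set.Ioo 0 Real.pi,
            φ (FreeProb.rho v) =
              1 / Real.pi * Real.sin v * Real.exp (-(v * Real.cot v))) ∧
          (∀ x, x ∉ Set.Ioo 0 (Real.exp 1) → φ x = 0) ∧
          ν = volume.withDensity fun x => ENNReal.ofReal (φ x)) ∧
    (∀ {H : Type*} [NormedAddCommGroup H] [InnerProductSpace ℂ H] [CompleteSpace H]
      (M : VonNeumannAlgebra H) (τ : M.toStarSubalgebra →ₗ[ℂ] ℂ) (T : M.toStarSubalgebra),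
      FreeProb.IsFaithfulNormalState M τ →
      FreeProb.IsDTElement τ (Measure.dirac (0 : ℂ)) 1 T →
      ‖(T : H →L[ℂ] H)‖ = Real.sqrt (Real.exp 1) ∧
      (T : H →L[ℂ] H).ker = ⊥ ∧
      (star (T : H →L[ℂ] H) * (T : H →L[ℂ] H)).ker = ⊥) := by
  refine ⟨fun {A} _ _ _ _ τ T _ hT => ?_, fun {H} _ _ _ M τ T hτ hT => ?_⟩
  · have hν := FreeProb.isDistribution_dtLaw hT
    refine ⟨FreeProb.dtLaw, hν, fun ν' hν' => ?_, withDensity_absolutelyContinuous _ _,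
      FreeProb.support_dtLaw, FreeProb.bijOn_rho, FreeProb.dtDensity,
      FreeProb.measurable_dtDensity, fun v hv => FreeProb.dtDensity_rho hv,
      fun x hx => FreeProb.dtDensity_of_notMem hx, rfl⟩
    have := hν'.isProbabilityMeasure
    exact FreeProb.measure_eq_of_moments hν'.isCompact_support hν.isCompact_support fun p =>
      Complex.ofReal_injective ((hν'.moment p).symm.trans (hν.moment p))
  · have hν := FreeProb.isDistribution_dtLaw hT
    have ha : IsSelfAdjoint ((star T * T : M.toStarSubalgebra) : H →L[ℂ] H) :=
      IsSelfAdjoint.star_mul_self (T : H →L[ℂ] H)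
    have hspec := (FreeProb.spectrum_eq_support hτ ha hν).trans FreeProb.support_dtLaw
    have hker := FreeProb.ker_eq_bot_of_measure_singleton hτ ha hν
      (withDensity_absolutelyContinuous volume _ (measure_singleton (0 : ℝ)))
    change spectrum ℝ (star (T : H →L[ℂ] H) * (T : H →L[ℂ] H)) = _ at hspec
    refine ⟨?_, ?_, hker⟩
    · rw [← Real.sqrt_mul_self (norm_nonneg (T : H →L[ℂ] H)), ← CStarRing.norm_star_mul_self]
      exact congrArg Real.sqrt (FreeProb.norm_eq_of_spectrum_eq_Icc ha (Real.exp_pos 1).le hspec)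
    -- The kernel of T is contained in that of T*T, which is already known to be trivial.
    · refine (Submodule.eq_bot_iff _).2 fun x hx => (Submodule.eq_bot_iff _).1 hker x ?_
      change star (T : H →L[ℂ] H) ((T : H →L[ℂ] H) x) = 0
      rw [show (T : H →L[ℂ] H) x = 0 from hx, map_zero]
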